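/- Let $H$ be a complex Hilbert space, $Z=\mathcal L(H)$ with the triple product $\{abc\}=\tfrac12(ab^*c+cb^*a)$, put $Q(e)z=\{eze\}$, $P_1(e)=Q(e)^2$, $P_{1/2}(e)z=2(\{eez\}-Q(e)^2z)$, $Z_{1/2}(e)=\{z:\{eez\}=\tfrac12 z\}$, and call $x,y\in Z$ orthogonal if $\{xyz\}=0$ for all $z\in Z$. Let $1\le r<\infty$ and let $M_r$ be the manifold of all projections of rank $r$ in $Z$, whose tangent space at $a$ is the self-adjoint part $Z_{1/2}(a)_s$ of $Z_{1/2}(a)$. A frame for $a\in M_r$ is a family $(a_1,\dots,a_r)$ of pairwise orthogonal minimal (rank one) projections with $\sum_k a_k=a$. For a minimal projection $e$ the Levi form $\langle\cdot,\cdot\rangle_e$ on $Z_{1/2}(e)$ is given by $\{euv\}=\langle v,u\rangle_e\,e$. For $a\in M_r$ and $u,v\in Z_{1/2}(a)$ put $$g_a(u,v)=\frac1r\sum_{k=1}^r\langle P_{1/2}(a_k)u,\,P_{1/2}(a_k)v\rangle_{a_k},\qquad (a_k)\text{ a frame for }a,$$ and $|u|_a=g_a(u,u)^{1/2}$ for tangent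 vectors $u$. Let $d$ be the Riemann distance, i.e. $d(a,b)$ is the infimum of the lengths $\int_0^1|\dot\gamma(t)|_{\gamma(t)}\,dt$ over the $C^1$ curves $\gamma:[0,1]\to M_r$ from $a$ to $b$. Let $\nabla$ be the connection $(\nabla_XY)_e=P_{1/2}(e)(Y'_eX_e)$ on $M_r$; its geodesics are the $C^2$ curves $\gamma$ in $M_r$, defined on an interval, with $P_{1/2}(\gamma(t))\ddot\gamma(t)=0$. Then: 1. $g_a$ does not depend on the choice of the frame, and $g$ is invariant under triple automorphisms, in particular under $\mathrm{Aut}^\circ(Z)$: if $\varphi$ is a (bounded linear) automorphism of the triple $Z$ and $a,\varphi(a)\in M_r$, then $g_{\varphi(a)}(\varphi u,\varphi v)=g_a(u,v)$ for all $u,v\in Z_{1/2}(a)$. 2. The $\nabla$-geodesics minimize the Riemann distance: if $\gamma$ is a $\nabla$-geodesic of $M_r$ on an interval $J$ and $s\le t$ in $J$ satisfy $(t-s)\|\dot\gamma(s)\|\le\pi/2$ (operator norm), then the length of $\gamma|_{[s,t]}$ equals $d(\gamma(s),\gamma(t))$. Moreover, for any two points $a,b\in M_r$ there is a $\nabla$-geodesic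 $\gamma:\mathbb R\to M_r$ with $\gamma(0)=a$, $\gamma(1)=b$ for which the length of $\gamma|_{[0,1]}$ is $d(a,b)$. 3. Let $a,b\in M_r$. There are a frame $(a_k)$ for $a$, pairwise orthogonal self-adjoint tripotents $w_k\in Z_{1/2}(a)\cap Z_{1/2}(a_k)$, numbers $\rho_k\ge0$ with $w_k\neq0$ whenever $\rho_k\ne0$, and angles $\theta_k\in[0,\pi/2]$ such that $$P_{1/2}(a)b=\sum_{k=1}^r\rho_kw_k,\qquad P_1(a)b=\sum_{k=1}^r\cos^2\theta_k\;a_k .$$ For every such choice, $\rho_k=\tfrac12\sin2\theta_k$ for all $k$ and $$d(a,b)=\frac1{\sqrt r}\Big(\sum_{k=1}^r\theta_k^2\Big)^{1/2}.$$ 4. For $r=1$ this is the Fubini–Study distance: if $\alpha,\beta\in H$ are unit vectors, then $d\big((\cdot,\alpha)\alpha,(\cdot,\beta)\beta\big)=\arccos|(\alpha,\beta)|$. -/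

import Mathlib

open scoped ENNReal InnerProductSpace

noncomputable section

namespace FiniteRankProj

variable {H : Type*} [NormedAddCommGroup H] [InnerProductSpace ℂ H] [CompleteSpace H]

/-! Throughout, `Z` is the space `H →L[ℂ] H` of bounded operators on a complex Hilbert space. -/

/-- The Jordan triple product `{a b c} = (a b* c + c b* a) / 2` of `Z`. -/
def triple (a b c : H →L[ℂ] H) : H →L[ℂ] H :=
  (1 / 2 : ℂ) • (a * star b * c + c * star b * a)

/-- Orthogonality in the triple sense: the operator `x □ y : z ↦ {x y z}` vanishes. -/
def TripleOrthogonal (x y : H →L[ℂ] H) : Prop := ∀ z, triple x y z = 0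

/-- Tripotents. -/
def IsTripotent (e : H →L[ℂ] H) : Prop := triple e e e = e

/-- The quadratic operator `Q(e) z = {e z e}`. -/
def quad (e z : H →L[ℂ] H) : H →L[ℂ] H := triple e z e

/-- The Peirce projection `P₁(e) = Q(e)²`. -/
def peirceOne (e z : H →L[ℂ] H) : H →L[ℂ] H := quad e (quad e z)

/-- The Peirce projection `P_{1/2}(e) = 2 (e □ e - Q(e)²)`. -/
def peirceHalf (e z : H →L[ℂ] H) : H →L[ℂ] H :=
  (2 : ℂ) • (triple e e z - quad e (quad e z))

/-- The Peirce space `Z_{1/2}(e)`: the eigenspace of `e □ e` for the eigenvalue `1/2`. -/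
def halfSpace (e : H →L[ℂ] H) : Set (H →L[ℂ] H) :=
  {z | triple e e z = (1 / 2 : ℂ) • z}

/-- The self-adjoint part of `Z_{1/2}(e)`, i.e. the tangent space at a projection `e`. -/
def tangentAt (e : H →L[ℂ] H) : Set (H →L[ℂ] H) :=
  {z | z ∈ halfSpace e ∧ IsSelfAdjoint z}

/-- The manifold `M_r` of all (orthogonal) projections of rank `r`, as a subset of `Z`. -/
def Mr (H : Type*) [NormedAddCommGroup H] [InnerProductSpace ℂ H] [CompleteSpace H] (r : ℕ) :
    Set (H →L[ℂ] H) :=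
  {p | IsStarProjection p ∧ (p : H →ₗ[ℂ] H).rank = (r : Cardinal)}

/-- Nonzero minimal projections: nonzero projections `e` with `P₁(e) Z = ℂ e`. -/
def IsMinimalProjection (e : H →L[ℂ] H) : Prop :=
  IsStarProjection e ∧ e ≠ 0 ∧ Set.range (peirceOne e) = {z | ∃ c : ℂ, z = c • e}

/-- A frame for `a`: pairwise orthogonal minimal projections with sum `a`. -/
structure IsFrame {r : ℕ} (a : H →L[ℂ] H) (e : Fin r → H →L[ℂ] H) : Prop where
  minimal : ∀ k, IsMinimalProjection (e k)
  orthogonal : Pairwise fun j k => TripleOrthogonal (e j) (e k)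
  sum_eq : ∑ k, e k = a

open Classical in
/-- The Levi form at a nonzero minimal tripotent `e`: the number `⟨v, u⟩_e` with
`{e u v} = ⟨v, u⟩_e e` (which exists for `u, v ∈ Z_{1/2}(e)`; the value is `0` otherwise). -/
def leviForm (e v u : H →L[ℂ] H) : ℂ :=
  if h : ∃ c : ℂ, triple e u v = c • e then h.choose else 0

theorem leviForm_eq {e v u : H →L[ℂ] H} {c : ℂ} (he : e ≠ 0) (h : triple e u v = c • e) :
    leviForm e v u = c := by
  have hex : ∃ c : ℂ, triple e u v = c • e := ⟨c, h⟩
  have h1 : triple e u v = leviForm e v u • e := by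
    rw [leviForm, dif_pos hex]
    exact hex.choose_spec
  exact smul_left_injective ℂ he (h1.symm.trans h)

/-- The average of the Levi forms along a family `e`. If `e` is a frame for `a` and
`u ∈ Z_{1/2}(a)`, then `P_{1/2}(e_k) u` is the component of `u` in `Z_{1/2}(e_k)`. -/
def frameForm {r : ℕ} (e : Fin r → H →L[ℂ] H) (u v : H →L[ℂ] H) : ℂ :=
  (1 / (r : ℂ)) * ∑ k, leviForm (e k) (peirceHalf (e k) u) (peirceHalf (e k) v)

open Classical in
/-- The metric `g` of `M_r` at `a`, on `Z_{1/2}(a)`, computed in some frame for `a`. -/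
def metric (r : ℕ) (a u v : H →L[ℂ] H) : ℂ :=
  if h : ∃ e : Fin r → H →L[ℂ] H, IsFrame a e then frameForm h.choose u v else 0

/-- The norm of a tangent vector `u` at `a`. -/
def tangentNorm (r : ℕ) (a u : H →L[ℂ] H) : ℝ := √(metric r a u u).re

/-- The length over `[s, t]` of a curve in `M_r`. -/
def curveLength (r : ℕ) (γ : ℝ → H →L[ℂ] H) (s t : ℝ) : ℝ≥0∞ :=
  ∫⁻ τ in Set.Icc s t, ENNReal.ofReal (tangentNorm r (γ τ) (derivWithin γ (Set.Icc s t) τ))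

/-- The Riemann distance of `M_r`: the infimum of the lengths of the `C¹` curves in `M_r` from
`a` to `b`. -/
def riemannDist (r : ℕ) (a b : H →L[ℂ] H) : ℝ≥0∞ :=
  ⨅ (γ : ℝ → H →L[ℂ] H) (_ : ContDiffOn ℝ 1 γ (Set.Icc 0 1) ∧
    (∀ t ∈ Set.Icc (0 : ℝ) 1, γ t ∈ Mr H r) ∧ γ 0 = a ∧ γ 1 = b), curveLength r γ 0 1

/-- The covariant derivative, along a curve `γ` with parameter interval `J`, of a vector field `V`
along `γ`, for the connection `(∇_X Y)_e = P_{1/2}(e) (Y'_e X_e)`. -/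
def covDeriv (J : Set ℝ) (γ V : ℝ → H →L[ℂ] H) (t : ℝ) : H →L[ℂ] H :=
  peirceHalf (γ t) (derivWithin V J t)

/-- The `∇`-geodesics of `M_r` with parameter interval `J`: the curves with `∇_γ' γ' = 0`. -/
structure IsGeodesicOn (r : ℕ) (J : Set ℝ) (γ : ℝ → H →L[ℂ] H) : Prop where
  contDiffOn : ContDiffOn ℝ 2 γ J
  mem : ∀ t ∈ J, γ t ∈ Mr H r
  covDeriv_eq : ∀ t ∈ J, covDeriv J γ (derivWithin γ J) t = 0

/-- Automorphisms of the JB*-triple `Z`. -/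
def IsTripleAut (φ : (H →L[ℂ] H) ≃L[ℂ] (H →L[ℂ] H)) : Prop :=
  ∀ z, φ (triple z z z) = triple (φ z) (φ z) (φ z)

/-- Spectral data of `b` relative to `a`: a spectral decomposition `P_{1/2}(a) b = ∑ ρ_k w_k` with
`ρ_k ≥ 0` and pairwise orthogonal tripotents `w_k` tangent at `a`, an associated frame `(e_k)`
for `a` (so `w_k ∈ Z_{1/2}(e_k)`, which makes each `w_k` zero or of the form
`(·, α) ξ + (·, ξ) α` with unit vectors `α ∈ e_k H`, `ξ ⊥ a H`) in which also `P₁(a) b` is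
diagonal, `P₁(a) b = ∑ (cos θ_k)² e_k`, and angles `θ_k ∈ [0, π/2]`. -/
structure IsSpectralData {r : ℕ} (a b : H →L[ℂ] H) (e w : Fin r → H →L[ℂ] H)
    (ρ θ : Fin r → ℝ) : Prop where
  frame : IsFrame a e
  tangent : ∀ k, w k ∈ tangentAt a
  assoc : ∀ k, w k ∈ halfSpace (e k)
  tripotent : ∀ k, IsTripotent (w k)
  ne_zero : ∀ k, ρ k ≠ 0 → w k ≠ 0
  orthogonal : Pairwise fun j k => TripleOrthogonal (w j) (w k)
  nonneg : ∀ k, 0 ≤ ρ k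
  half_eq : peirceHalf a b = ∑ k, (ρ k : ℂ) • w k
  one_eq : peirceOne a b = ∑ k, ((Real.cos (θ k) ^ 2 : ℝ) : ℂ) • e k
  angle : ∀ k, θ k ∈ Set.Icc 0 (Real.pi / 2)

end FiniteRankProj

end

/-!
The tangent vectors at a projection `a` of finite rank are determined by their restrictions
`u|aH : aH → (aH)ᗮ`, and for an orthonormal basis `α` of `aH` the metric is
`g_a(u, u) = (1 / r) ∑ ‖u (α k)‖²` (`tangentNorm_eq`). As the trace of a compression this does not
depend on the basis. Triple automorphisms which map `a` to a projection map frames to frames and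
preserve the Levi forms, so the metric is invariant.

*Lower bound for the distance.* A `C¹` curve `γ` of projections has a horizontal lift: the equation
`β' = [γ', γ] β` carries an orthonormal basis `α` of the initial range to orthonormal bases of the
ranges, with velocities `γ' β` (`exists_horizontal_lift`). Hence `√r` times the length of `γ` is the
integral of `(∑ ‖β k'‖²)^{1/2}`. Each `β k` is a curve on the unit sphere from `α k` to a unit
vector in the final range `bH`, and the angle between these is at least `arccos ‖b (α k)‖`. So the
distance from `a` to `b` is at least `(1 / √r) (∑ arccos² ‖b (α k)‖)^{1/2}`, for every orthonormal
basis `α` of `aH` (`le_riemannDist`).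

*Upper bound.* If `α` diagonalizes the compression of `b` to `aH`, with `‖b (α k)‖ = cos (θ k)`,
then there are pairwise orthogonal `ξ k ∈ (aH)ᗮ` such that the vectors
`cos (t θ k) α k + sin (t θ k) ξ k` span `aH` for `t = 0` and `bH` for `t = 1`
(`exists_isRotationData`). The projections onto their spans form a geodesic with constant speed
`(1 / √r) (∑ (θ k)²)^{1/2}`, so that the lower bound is attained
(`IsRotationData.riemannDist_eq`).

*Geodesics.* For a geodesic the generator `[γ', γ]` is constant, so `γ` solves a linear equation
with constant coefficient. By uniqueness it is the rotation obtained from the singular value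
decomposition of its initial velocity `u` (`IsGeodesicOn.exists_eqOn`). The singular values are
at most `‖u‖`, whence the bound `π / 2` on the angles.

*Spectral data.* The frame in spectral data diagonalizes the compression of `b`, with eigenvalues
`cos² (θ k)`, so the distance formula is the one above; the value of `ρ k` is found by evaluating
`P_{1/2}(a) b` at a unit vector in the range of the `k`-th projection of the frame.
-/

noncomputable section

namespace FiniteRankProj

variable {H : Type*} [NormedAddCommGroup H] [InnerProductSpace ℂ H] [CompleteSpace H]

/-! ### Peirce calculus for projections -/

theorem quad_eq (e z : H →L[ℂ] H) : quad e z = e * star z * e := by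
  simp only [quad, triple, ← two_smul ℂ (e * star z * e), smul_smul]
  norm_num

theorem peirceOne_eq {e : H →L[ℂ] H} (he : IsStarProjection e) (z : H →L[ℂ] H) :
    peirceOne e z = e * z * e := by
  have h1 : e * e = e := he.isIdempotentElem
  have h2 : star e = e := he.isSelfAdjoint
  simp only [peirceOne, quad_eq, star_mul, star_star, h2]
  simp only [← mul_assoc, h1]
  simp only [mul_assoc, h1]

theorem triple_self_eq {e : H →L[ℂ] H} (he : IsStarProjection e) (z : H →L[ℂ] H) :
    triple e e z = (1 / 2 : ℂ) • (e * z + z * e) := by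
  have h1 : e * e = e := he.isIdempotentElem
  have h2 : star e = e := he.isSelfAdjoint
  rw [triple, h2, mul_assoc z, h1]

theorem peirceHalf_eq {e : H →L[ℂ] H} (he : IsStarProjection e) (z : H →L[ℂ] H) :
    peirceHalf e z = e * z + z * e - (2 : ℂ) • (e * z * e) := by
  have h := peirceOne_eq he z
  rw [peirceOne] at h
  rw [peirceHalf, h, triple_self_eq he, smul_sub, smul_smul]
  norm_num

theorem mem_halfSpace_iff {e : H →L[ℂ] H} (he : IsStarProjection e) {z : H →L[ℂ] H} :
    z ∈ halfSpace e ↔ e * z + z * e = z := by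
  have h2 : (1 / 2 : ℂ) ≠ 0 := by norm_num
  rw [halfSpace, Set.mem_ofPred_eq, triple_self_eq he]
  exact (smul_right_injective _ h2).eq_iff

theorem corner_eq_zero {e : H →L[ℂ] H} (he : IsStarProjection e) {z : H →L[ℂ] H}
    (hz : z ∈ halfSpace e) : e * z * e = 0 := by
  have h1 : e * e = e := he.isIdempotentElem
  have h := congrArg (fun x => e * x * e) ((mem_halfSpace_iff he).1 hz)
  simp only [mul_add, add_mul, ← mul_assoc, h1] at h
  simp only [mul_assoc, h1] at h
  simpa [mul_assoc] using h

theorem star_mem_halfSpace {e : H →L[ℂ] H} (he : IsStarProjection e) {z : H →L[ℂ] H}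
    (hz : z ∈ halfSpace e) : star z ∈ halfSpace e := by
  have h2 : star e = e := he.isSelfAdjoint
  rw [mem_halfSpace_iff he] at hz ⊢
  conv_rhs => rw [← hz]
  rw [star_add, star_mul, star_mul, h2, add_comm]

/-! ### Frames and orthonormal families -/

/-- The operator `∑ (·, α k) α k`; for an orthonormal family it is the projection onto its span. -/
def sumProj {r : ℕ} (α : Fin r → H) : H →L[ℂ] H :=
  ∑ k, InnerProductSpace.rankOne ℂ (α k) (α k)

omit [CompleteSpace H] in
theorem sumProj_apply {r : ℕ} (α : Fin r → H) (x : H) :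
    sumProj α x = ∑ k, ⟪α k, x⟫_ℂ • α k := by
  simp [sumProj]

theorem star_rankOne (x y : H) :
    star (InnerProductSpace.rankOne ℂ x y) = InnerProductSpace.rankOne ℂ y x := by
  rw [ContinuousLinearMap.star_eq_adjoint, InnerProductSpace.adjoint_rankOne]

theorem isSelfAdjoint_sumProj {r : ℕ} (α : Fin r → H) : IsSelfAdjoint (sumProj α) := by
  rw [IsSelfAdjoint, sumProj, star_sum]
  exact Finset.sum_congr rfl fun k _ => star_rankOne _ _

omit [CompleteSpace H] in
theorem sumProj_apply_self {r : ℕ} {α : Fin r → H} (hα : Orthonormal ℂ α) (j : Fin r) :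
    sumProj α (α j) = α j := by
  simp [sumProj_apply, orthonormal_iff_ite.1 hα]

theorem isStarProjection_sumProj {r : ℕ} {α : Fin r → H} (hα : Orthonormal ℂ α) :
    IsStarProjection (sumProj α) := by
  refine ⟨?_, isSelfAdjoint_sumProj α⟩
  ext x
  rw [mul_apply_eq_comp]
  conv_lhs => rw [sumProj_apply α x]
  simp only [map_sum, map_smul, sumProj_apply_self hα]
  rw [sumProj_apply]

theorem isStarProjection_rankOne {α : H} (hα : ‖α‖ = 1) :
    IsStarProjection (InnerProductSpace.rankOne ℂ α α) :=
  InnerProductSpace.isStarProjection_rankOne_self hα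

omit [CompleteSpace H] in
theorem rankOne_mul_mul_rankOne (α : H) (z : H →L[ℂ] H) :
    InnerProductSpace.rankOne ℂ α α * z * InnerProductSpace.rankOne ℂ α α =
      ⟪α, z α⟫_ℂ • InnerProductSpace.rankOne ℂ α α := by
  ext x
  simp [smul_smul, mul_comm]

theorem inner_apply_comm {e : H →L[ℂ] H} (he : IsSelfAdjoint e) (x y : H) :
    ⟪e x, y⟫_ℂ = ⟪x, e y⟫_ℂ := by
  have h2 : ContinuousLinearMap.adjoint e = e := he
  conv_lhs => rw [← h2]
  exact ContinuousLinearMap.adjoint_inner_left e y x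

theorem isMinimalProjection_rankOne {α : H} (hα : ‖α‖ = 1) :
    IsMinimalProjection (InnerProductSpace.rankOne ℂ α α) := by
  have hp := isStarProjection_rankOne hα
  have h0 : α ≠ 0 := by rintro rfl; simp at hα
  refine ⟨hp, InnerProductSpace.rankOne_ne_zero h0 h0, ?_⟩
  ext z
  simp only [Set.mem_range, Set.mem_ofPred_eq]
  constructor
  · rintro ⟨y, rfl⟩
    exact ⟨_, by rw [peirceOne_eq hp, rankOne_mul_mul_rankOne]⟩
  · rintro ⟨c, rfl⟩
    refine ⟨c • InnerProductSpace.rankOne ℂ α α, ?_⟩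
    rw [peirceOne_eq hp, rankOne_mul_mul_rankOne]
    simp [hα]

theorem IsMinimalProjection.exists_rankOne {e : H →L[ℂ] H} (he : IsMinimalProjection e) :
    ∃ α : H, ‖α‖ = 1 ∧ e = InnerProductSpace.rankOne ℂ α α := by
  obtain ⟨hp, h0, hr⟩ := he
  have h1 : e * e = e := hp.isIdempotentElem
  obtain ⟨x, hx⟩ : ∃ x, e x ≠ 0 := by
    by_contra! h
    exact h0 (ContinuousLinearMap.ext h)
  set α : H := ((‖e x‖⁻¹ : ℝ) : ℂ) • e x with hα
  have hn : ‖α‖ = 1 := by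
    have : ‖e x‖ ≠ 0 := norm_ne_zero_iff.2 hx
    simp [hα, norm_smul, this]
  have heα : e α = α := by
    rw [hα, map_smul, ← mul_apply_eq_comp, h1]
  refine ⟨α, hn, ?_⟩
  -- compress the rank one projection onto `α`, which lies below `e`, to a multiple of `e`
  have hm : peirceOne e (InnerProductSpace.rankOne ℂ α α) ∈ {z | ∃ c : ℂ, z = c • e} :=
    hr ▸ Set.mem_range_self _
  obtain ⟨c, hc⟩ := hm
  rw [peirceOne_eq hp] at hc
  have hc' : e * InnerProductSpace.rankOne ℂ α α * e = InnerProductSpace.rankOne ℂ α α := by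
    ext y
    simp [heα, ← inner_apply_comm hp.isSelfAdjoint]
  rw [hc'] at hc
  have h2 := congrArg (fun z : H →L[ℂ] H => z α) hc
  have h3 : α = c • α := by simpa [hn, heα] using h2
  have hα0 : α ≠ 0 := by rintro h; simp [h] at hn
  have h4 : c = 1 := by
    have : (1 : ℂ) • α = c • α := by rw [one_smul]; exact h3
    exact (smul_left_injective ℂ hα0 this).symm
  rw [hc, h4, one_smul]

theorem tripleOrthogonal_rankOne {α β : H} (hβ : ‖β‖ = 1) :
    TripleOrthogonal (InnerProductSpace.rankOne ℂ α α) (InnerProductSpace.rankOne ℂ β β) ↔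
      ⟪α, β⟫_ℂ = 0 := by
  constructor
  · intro h
    have h1 := congrArg (fun z : H →L[ℂ] H => ⟪β, z β⟫_ℂ) (h 1)
    simp only [triple, star_rankOne] at h1
    simpa [hβ, inner_eq_zero_symm (x := β)] using h1
  · intro h z
    have h' : ⟪β, α⟫_ℂ = 0 := inner_eq_zero_symm.1 h
    ext x
    simp [triple, star_rankOne, h, h']

theorem isFrame_rankOne {r : ℕ} {α : Fin r → H} (hα : Orthonormal ℂ α) :
    IsFrame (sumProj α) fun k => InnerProductSpace.rankOne ℂ (α k) (α k) :=
  ⟨fun k => isMinimalProjection_rankOne (hα.1 k),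
    fun _ k hjk => (tripleOrthogonal_rankOne (hα.1 k)).2 (hα.2 hjk), rfl⟩

theorem IsFrame.exists_orthonormal {r : ℕ} {a : H →L[ℂ] H} {e : Fin r → H →L[ℂ] H}
    (he : IsFrame a e) : ∃ α : Fin r → H, Orthonormal ℂ α ∧ sumProj α = a ∧
      ∀ k, e k = InnerProductSpace.rankOne ℂ (α k) (α k) := by
  choose α hα using fun k => (he.minimal k).exists_rankOne
  refine ⟨α, ⟨fun k => (hα k).1, fun j k hjk => ?_⟩, ?_, fun k => (hα k).2⟩
  · have h := he.orthogonal hjk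
    simp only [(hα j).2, (hα k).2] at h
    exact (tripleOrthogonal_rankOne (hα k).1).1 h
  · rw [← he.sum_eq, sumProj]
    exact Finset.sum_congr rfl fun k _ => ((hα k).2).symm

omit [CompleteSpace H] in
theorem range_sumProj {r : ℕ} {α : Fin r → H} (hα : Orthonormal ℂ α) :
    (sumProj α : H →ₗ[ℂ] H).range = Submodule.span ℂ (Set.range α) := by
  apply le_antisymm
  · rintro _ ⟨x, rfl⟩
    rw [ContinuousLinearMap.coe_coe, sumProj_apply]
    exact Submodule.sum_mem _ fun k _ =>
      Submodule.smul_mem _ _ (Submodule.subset_span (Set.mem_range_self k))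
  · rw [Submodule.span_le]
    rintro _ ⟨k, rfl⟩
    exact ⟨α k, sumProj_apply_self hα k⟩

theorem sumProj_mem_Mr {r : ℕ} {α : Fin r → H} (hα : Orthonormal ℂ α) : sumProj α ∈ Mr H r := by
  refine ⟨isStarProjection_sumProj hα, ?_⟩
  rw [LinearMap.rank, range_sumProj hα, rank_span hα.linearIndependent,
    ← Set.cast_ncard (Set.finite_range α),
    Set.ncard_range_of_injective hα.linearIndependent.injective, Nat.card_fin]

theorem finiteDimensional_range {r : ℕ} {a : H →L[ℂ] H} (ha : a ∈ Mr H r) :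
    FiniteDimensional ℂ (a : H →ₗ[ℂ] H).range := by
  have h : Module.rank ℂ (a : H →ₗ[ℂ] H).range = (r : Cardinal) := ha.2
  exact Module.rank_lt_aleph0_iff.1 (h ▸ Cardinal.natCast_lt_aleph0)

theorem finrank_range {r : ℕ} {a : H →L[ℂ] H} (ha : a ∈ Mr H r) :
    Module.finrank ℂ (a : H →ₗ[ℂ] H).range = r := by
  have h : Module.rank ℂ (a : H →ₗ[ℂ] H).range = (r : Cardinal) := ha.2
  exact Module.finrank_eq_of_rank_eq h

theorem apply_of_mem_range {a : H →L[ℂ] H} (ha : IsStarProjection a) {x : H}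
    (hx : x ∈ (a : H →ₗ[ℂ] H).range) : a x = x := by
  obtain ⟨y, rfl⟩ := hx
  have h1 : a * a = a := ha.isIdempotentElem
  rw [ContinuousLinearMap.coe_coe, ← mul_apply_eq_comp, h1]

/-- An orthonormal basis of the range of `a ∈ M_r` represents `a`. -/
theorem sumProj_orthonormalBasis {r : ℕ} {a : H →L[ℂ] H} (ha : a ∈ Mr H r)
    (b : OrthonormalBasis (Fin r) ℂ (a : H →ₗ[ℂ] H).range) :
    Orthonormal ℂ (fun k => (b k : H)) ∧ sumProj (fun k => (b k : H)) = a := by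
  refine ⟨b.orthonormal.comp_linearIsometry (Submodule.subtypeₗᵢ _), ?_⟩
  ext x
  have h := b.sum_repr' ⟨a x, x, rfl⟩
  rw [Subtype.ext_iff] at h
  rw [sumProj_apply]
  simp only [Submodule.coe_sum, Submodule.coe_smul, Submodule.coe_inner] at h
  rw [← h]
  refine Finset.sum_congr rfl fun k _ => ?_
  rw [← inner_apply_comm ha.1.isSelfAdjoint, apply_of_mem_range ha.1 (b k).2]

theorem exists_orthonormal_of_mem_Mr {r : ℕ} {a : H →L[ℂ] H} (ha : a ∈ Mr H r) :
    ∃ α : Fin r → H, Orthonormal ℂ α ∧ sumProj α = a := by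
  have := finiteDimensional_range ha
  exact ⟨_, sumProj_orthonormalBasis ha
    ((stdOrthonormalBasis ℂ _).reindex (finCongr (finrank_range ha)))⟩

/-! ### The metric -/

/-- The Levi form of the components of `u` and `v` in the half space of one member of a frame is a
diagonal coefficient of `(v* u + u v*) / 2`. -/
theorem leviForm_peirceHalf {r : ℕ} {α : Fin r → H} (hα : Orthonormal ℂ α) {u v : H →L[ℂ] H}
    (hu : u ∈ halfSpace (sumProj α)) (hv : v ∈ halfSpace (sumProj α)) (k : Fin r) :
    leviForm (InnerProductSpace.rankOne ℂ (α k) (α k))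
      (peirceHalf (InnerProductSpace.rankOne ℂ (α k) (α k)) u)
      (peirceHalf (InnerProductSpace.rankOne ℂ (α k) (α k)) v) =
        (1 / 2 : ℂ) * ⟪α k, (star v * u + u * star v) (α k)⟫_ℂ := by
  set e := InnerProductSpace.rankOne ℂ (α k) (α k) with he
  have hp : IsStarProjection e := isStarProjection_rankOne (hα.1 k)
  have ha := isStarProjection_sumProj hα
  have h1 : e * e = e := hp.isIdempotentElem
  have h2 : star e = e := hp.isSelfAdjoint
  have hea : e * sumProj α = e := by
    ext x
    simp [he, ← inner_apply_comm ha.isSelfAdjoint,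
      sumProj_apply_self hα]
  have hae : sumProj α * e = e := by
    have := congrArg star hea
    rwa [star_mul, h2, ha.isSelfAdjoint.star_eq] at this
  -- the corner `e z e` vanishes for `z` in the half space of the larger projection
  have hc : ∀ z ∈ halfSpace (sumProj α), e * z * e = 0 := by
    intro z hz
    have h3 := congrArg (fun x => e * x * e) (corner_eq_zero ha hz)
    simp only [← mul_assoc, hea] at h3
    simpa [mul_assoc, hae] using h3
  have hv' := star_mem_halfSpace ha hv
  have hcu := hc u hu
  have hcv := hc v hv
  have hcv' := hc _ hv'
  rw [peirceHalf_eq hp, peirceHalf_eq hp, hcu, hcv, smul_zero, sub_zero, sub_zero]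
  refine leviForm_eq (isMinimalProjection_rankOne (hα.1 k)).2.1 ?_
  have hl : e * (star v * e + e * star v) = e * star v := by
    rw [mul_add, ← mul_assoc, hcv', zero_add, ← mul_assoc, h1]
  have hr : (star v * e + e * star v) * e = star v * e := by
    rw [add_mul, hcv', add_zero, mul_assoc, h1]
  rw [triple, star_add, star_mul, star_mul, h2, hl, mul_assoc (e * u + u * e), hr]
  have h4 : e * star v * (e * u + u * e) = e * (star v * u) * e := by
    rw [mul_add, ← mul_assoc, hcv', zero_mul, zero_add]
    simp only [mul_assoc]
  have h5 : (e * u + u * e) * (star v * e) = e * (u * star v) * e := by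
    rw [add_mul, mul_assoc u, ← mul_assoc e (star v), hcv', mul_zero, add_zero]
    simp only [mul_assoc]
  rw [h4, h5, ← add_mul, ← mul_add, rankOne_mul_mul_rankOne, smul_smul]

theorem frameForm_eq {r : ℕ} {α : Fin r → H} (hα : Orthonormal ℂ α) {u v : H →L[ℂ] H}
    (hu : u ∈ halfSpace (sumProj α)) (hv : v ∈ halfSpace (sumProj α)) :
    frameForm (fun k => InnerProductSpace.rankOne ℂ (α k) (α k)) u v =
      (1 / (r : ℂ)) * ∑ k, (1 / 2 : ℂ) * ⟪α k, (star v * u + u * star v) (α k)⟫_ℂ := by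
  rw [frameForm]
  congr 1
  exact Finset.sum_congr rfl fun k _ => leviForm_peirceHalf hα hu hv k

/-- The trace of the compression of an operator to the range of a finite rank projection does
not depend on the orthonormal basis in which it is computed. -/
theorem sum_inner_apply_eq {r : ℕ} {α β : Fin r → H} (hα : Orthonormal ℂ α)
    (hβ : Orthonormal ℂ β) (h : sumProj α = sumProj β) (T : H →L[ℂ] H) :
    ∑ k, ⟪α k, T (α k)⟫_ℂ = ∑ k, ⟪β k, T (β k)⟫_ℂ := by
  have h1 : ∀ k, ⟪α k, T (α k)⟫_ℂ = ∑ j, ⟪β j, α k⟫_ℂ * ⟪α k, T (β j)⟫_ℂ := by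
    intro k
    have h2 : T (α k) = ∑ j, ⟪β j, α k⟫_ℂ • T (β j) := by
      conv_lhs => rw [← sumProj_apply_self hα k, h, sumProj_apply, map_sum]
      exact Finset.sum_congr rfl fun j _ => map_smul _ _ _
    rw [h2, inner_sum]
    exact Finset.sum_congr rfl fun j _ => inner_smul_right _ _ _
  rw [Finset.sum_congr rfl fun k _ => h1 k, Finset.sum_comm]
  refine Finset.sum_congr rfl fun j _ => ?_
  have h3 : sumProj α (β j) = β j := by rw [h, sumProj_apply_self hβ]
  conv_rhs => rw [← h3, inner_apply_comm (isSelfAdjoint_sumProj α), sumProj_apply, inner_sum]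
  refine Finset.sum_congr rfl fun k _ => ?_
  rw [inner_smul_right, h3, mul_comm]

theorem frameForm_eq_frameForm {r : ℕ} {a : H →L[ℂ] H} {e f : Fin r → H →L[ℂ] H}
    (he : IsFrame a e) (hf : IsFrame a f) {u v : H →L[ℂ] H}
    (hu : u ∈ halfSpace a) (hv : v ∈ halfSpace a) : frameForm e u v = frameForm f u v := by
  obtain ⟨α, hα, rfl, hαe⟩ := he.exists_orthonormal
  obtain ⟨β, hβ, hβα, hβf⟩ := hf.exists_orthonormal
  rw [funext hαe, funext hβf, frameForm_eq hα hu hv,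
    frameForm_eq hβ (by rwa [hβα]) (by rwa [hβα]), ← Finset.mul_sum, ← Finset.mul_sum,
    sum_inner_apply_eq hα hβ hβα.symm]

theorem metric_eq_frameForm {r : ℕ} {a : H →L[ℂ] H} {e : Fin r → H →L[ℂ] H} (he : IsFrame a e)
    {u v : H →L[ℂ] H} (hu : u ∈ halfSpace a) (hv : v ∈ halfSpace a) :
    metric r a u v = frameForm e u v := by
  have hex : ∃ f : Fin r → H →L[ℂ] H, IsFrame a f := ⟨e, he⟩
  rw [metric, dif_pos hex]
  exact frameForm_eq_frameForm hex.choose_spec he hu hv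

theorem tangentNorm_eq {r : ℕ} {α : Fin r → H} (hα : Orthonormal ℂ α) {u : H →L[ℂ] H}
    (hu : u ∈ tangentAt (sumProj α)) :
    tangentNorm r (sumProj α) u = 1 / √(r : ℝ) * √(∑ k, ‖u (α k)‖ ^ 2) := by
  have h1 : star u = u := hu.2
  rw [tangentNorm, metric_eq_frameForm (isFrame_rankOne hα) hu.1 hu.1, frameForm_eq hα hu.1 hu.1]
  have h2 : ∀ k, (1 / 2 : ℂ) * ⟪α k, (star u * u + u * star u) (α k)⟫_ℂ =
      ((‖u (α k)‖ ^ 2 : ℝ) : ℂ) := by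
    intro k
    rw [h1, add_apply, inner_add_right, mul_apply_eq_comp,
      ← inner_apply_comm hu.2, inner_self_eq_norm_sq_to_K]
    push_cast
    simp
    ring
  simp only [h2]
  rw [← Complex.ofReal_sum, ← Complex.ofReal_natCast, ← Complex.ofReal_one, ← Complex.ofReal_div,
    ← Complex.ofReal_mul, Complex.ofReal_re, Real.sqrt_mul (by positivity),
    Real.sqrt_div zero_le_one, Real.sqrt_one]

/-! ### Triple automorphisms -/

theorem triple_comm (x y z : H →L[ℂ] H) : triple x y z = triple z y x := by
  rw [triple, triple, add_comm]

theorem triple_add_left (x x' y z : H →L[ℂ] H) :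
    triple (x + x') y z = triple x y z + triple x' y z := by
  simp only [triple, add_mul, mul_add, ← smul_add]
  congr 1
  abel

theorem triple_add_middle (x y y' z : H →L[ℂ] H) :
    triple x (y + y') z = triple x y z + triple x y' z := by
  simp only [triple, star_add, add_mul, mul_add, ← smul_add]
  congr 1
  abel

theorem triple_smul_left (c : ℂ) (x y z : H →L[ℂ] H) :
    triple (c • x) y z = c • triple x y z := by
  simp only [triple, smul_mul_assoc, mul_smul_comm, ← smul_add]
  rw [smul_comm]

theorem triple_smul_middle (c : ℂ) (x y z : H →L[ℂ] H) :
    triple x (c • y) z = (starRingEnd ℂ c) • triple x y z := by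
  simp only [triple, star_smul, smul_mul_assoc, mul_smul_comm, ← smul_add]
  rw [smul_comm]
  rfl

/-- Polarization: a map which is additive and complex homogeneous in its outer variables,
symmetric in them, and conjugate linear in its middle variable vanishes with its diagonal. -/
theorem eq_zero_of_diag_eq_zero {V W : Type*} [AddCommGroup V] [Module ℂ V] [AddCommGroup W]
    [Module ℂ W] (D : V → V → V → W) (hsymm : ∀ x y z, D x y z = D z y x)
    (hadd : ∀ x x' y z, D (x + x') y z = D x y z + D x' y z)
    (hadd' : ∀ x y y' z, D x (y + y') z = D x y z + D x y' z)
    (hsmul : ∀ (c : ℂ) x y z, D (c • x) y z = c • D x y z)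
    (hsmul' : ∀ (c : ℂ) x y z, D x (c • y) z = (starRingEnd ℂ c) • D x y z)
    (hdiag : ∀ x, D x x x = 0) (x y z : V) : D x y z = 0 := by
  have hadd2 : ∀ x y z z', D x y (z + z') = D x y z + D x y z' := fun x y z z' => by
    rw [hsymm, hadd, hsymm z, hsymm z']
  have hsmul2 : ∀ (c : ℂ) x y z, D x y (c • z) = c • D x y z := fun c x y z => by
    rw [hsymm, hsmul, hsymm]
  have key : ∀ x y, D y x y = 0 := by
    intro x y
    have h : ∀ c : ℂ, (2 * c) • D x x y + (starRingEnd ℂ c) • D x y x + (c * c) • D y x y +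
        (2 * (c * starRingEnd ℂ c)) • D x y y = 0 := by
      intro c
      have h1 := hdiag (x + c • y)
      simp only [hadd, hadd', hadd2, hsmul, hsmul', hsmul2, hdiag, smul_zero, add_zero,
        zero_add, hsymm y x x, hsymm y y x] at h1
      rw [← h1]
      module
    have h1 := h 1
    have h2 := h (-1)
    have h3 := h Complex.I
    have h4 := h (-Complex.I)
    simp only [map_neg, map_one, Complex.conj_I] at h1 h2 h3 h4
    have h5 : (4 : ℂ) • D y x y = 0 := by
      have h6 : (4 : ℂ) • D y x y = (2 - 2 * (Complex.I * Complex.I)) • D y x y := by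
        rw [Complex.I_mul_I]; norm_num
      rw [h6]
      have h7 : (4 + 4 * (Complex.I * Complex.I)) • D x y y = 0 := by
        rw [Complex.I_mul_I]; norm_num
      linear_combination (norm := module) h1 + h2 - h3 - h4 - h7
    exact (smul_eq_zero.1 h5).resolve_left (by norm_num)
  have h1 := key y (x + z)
  simp only [hadd, hadd2, key, zero_add, add_zero, hsymm z y x] at h1
  rw [← two_smul ℂ] at h1
  exact (smul_eq_zero.1 h1).resolve_left two_ne_zero

variable {φ : (H →L[ℂ] H) ≃L[ℂ] (H →L[ℂ] H)}

theorem IsTripleAut.map_triple (hφ : IsTripleAut φ) (x y z : H →L[ℂ] H) :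
    φ (triple x y z) = triple (φ x) (φ y) (φ z) := by
  rw [← sub_eq_zero]
  refine eq_zero_of_diag_eq_zero (fun x y z => φ (triple x y z) - triple (φ x) (φ y) (φ z))
    ?_ ?_ ?_ ?_ ?_ ?_ x y z
  · intro x y z
    simp only [triple_comm x, triple_comm (φ x)]
  · intro x x' y z
    simp only [triple_add_left, map_add]
    abel
  · intro x y y' z
    simp only [triple_add_middle, map_add]
    abel
  · intro c x y z
    simp only [triple_smul_left, map_smul, smul_sub]
  · intro c x y z
    simp only [triple_smul_middle, map_smul, smul_sub]
  · intro x
    simp only [hφ x, sub_self]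

theorem IsTripleAut.map_quad (hφ : IsTripleAut φ) (x y : H →L[ℂ] H) :
    φ (quad x y) = quad (φ x) (φ y) := hφ.map_triple _ _ _

theorem IsTripleAut.map_peirceOne (hφ : IsTripleAut φ) (x y : H →L[ℂ] H) :
    φ (peirceOne x y) = peirceOne (φ x) (φ y) := by
  rw [peirceOne, hφ.map_quad, hφ.map_quad, peirceOne]

theorem IsTripleAut.map_peirceHalf (hφ : IsTripleAut φ) (x y : H →L[ℂ] H) :
    φ (peirceHalf x y) = peirceHalf (φ x) (φ y) := by
  rw [peirceHalf, map_smul, map_sub, hφ.map_triple, hφ.map_quad, hφ.map_quad, peirceHalf]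

theorem IsTripleAut.map_mem_halfSpace (hφ : IsTripleAut φ) {a u : H →L[ℂ] H}
    (hu : u ∈ halfSpace a) : φ u ∈ halfSpace (φ a) := by
  have h : triple a a u = (1 / 2 : ℂ) • u := hu
  have h' := congrArg φ h
  rwa [hφ.map_triple, map_smul] at h'

theorem IsTripleAut.leviForm_map (hφ : IsTripleAut φ) {e : H →L[ℂ] H} (he : e ≠ 0)
    (v u : H →L[ℂ] H) : leviForm (φ e) (φ v) (φ u) = leviForm e v u := by
  by_cases h : ∃ c : ℂ, triple e u v = c • e
  · obtain ⟨c, hc⟩ := h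
    rw [leviForm_eq he hc]
    refine leviForm_eq (by simpa using he) ?_
    rw [← hφ.map_triple, hc, map_smul]
  · have h' : ¬ ∃ c : ℂ, triple (φ e) (φ u) (φ v) = c • φ e := by
      rintro ⟨c, hc⟩
      refine h ⟨c, φ.injective ?_⟩
      rw [hφ.map_triple, hc, map_smul]
    rw [leviForm, leviForm, dif_neg h, dif_neg h']

/-- Below a projection, the condition of being a projection is expressed by the triple product. -/
theorem IsTripleAut.isStarProjection_map (hφ : IsTripleAut φ) {a e : H →L[ℂ] H}
    (ha : IsStarProjection a) (ha' : IsStarProjection (φ a)) (he : IsStarProjection e)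
    (hae : a * e = e) : IsStarProjection (φ e) := by
  have h1 : star e = e := he.isSelfAdjoint
  have h1' : e * e = e := he.isIdempotentElem
  have h2 : star a = a := ha.isSelfAdjoint
  have h3 : e * a = e := by
    have := congrArg star hae
    rwa [star_mul, h1, h2] at this
  have h5 : star (φ a) = φ a := ha'.isSelfAdjoint
  have h6 : φ a * φ a = φ a := ha'.isIdempotentElem
  have h4 : φ e = φ a * star (φ e) * φ a := by
    rw [← quad_eq, ← hφ.map_quad, quad_eq, h1, hae, h3]
  have h7 : φ a * φ e = φ e := by
    conv_lhs => rw [h4]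
    rw [← mul_assoc, ← mul_assoc, h6, ← h4]
  have h8 : φ e * φ a = φ e := by
    conv_lhs => rw [h4]
    rw [mul_assoc, h6, ← h4]
  have h9 : star (φ e) = φ e := by
    conv_rhs => rw [h4]
    have h := congrArg star h7
    have h' := congrArg star h8
    rw [star_mul, h5] at h h'
    rw [h', h]
  refine ⟨?_, h9⟩
  have h10 : triple e e a = e := by
    rw [triple_self_eq he, h3, hae, ← two_smul ℂ e, smul_smul]
    norm_num
  have h11 := congrArg φ h10
  rw [hφ.map_triple, triple, h9, mul_assoc (φ e) (φ e), h8, h7, ← two_smul ℂ, smul_smul] at h11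
  norm_num at h11
  exact h11

theorem IsTripleAut.isFrame_map (hφ : IsTripleAut φ) {r : ℕ} {a : H →L[ℂ] H}
    {e : Fin r → H →L[ℂ] H} (he : IsFrame a e) (ha' : IsStarProjection (φ a)) :
    IsFrame (φ a) fun k => φ (e k) := by
  refine ⟨fun k => ⟨?_, ?_, ?_⟩, ?_, ?_⟩
  · obtain ⟨α, hα, rfl, hαe⟩ := he.exists_orthonormal
    refine hφ.isStarProjection_map (isStarProjection_sumProj hα) ha' (he.minimal k).1 ?_
    rw [hαe k]
    ext x
    simp [sumProj_apply_self hα]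
  · simpa using (he.minimal k).2.1
  · ext z
    rw [Set.mem_range, Set.mem_ofPred_eq]
    have h := Set.ext_iff.1 (he.minimal k).2.2 (φ.symm z)
    rw [Set.mem_range, Set.mem_ofPred_eq] at h
    constructor
    · rintro ⟨y, rfl⟩
      obtain ⟨c, hc⟩ := h.1 ⟨φ.symm y, φ.injective (by
        rw [hφ.map_peirceOne, φ.apply_symm_apply, φ.apply_symm_apply])⟩
      exact ⟨c, by rw [← map_smul, ← hc, φ.apply_symm_apply]⟩
    · rintro ⟨c, rfl⟩
      obtain ⟨y, hy⟩ := h.2 ⟨c, by rw [map_smul, φ.symm_apply_apply]⟩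
      exact ⟨φ y, by rw [← hφ.map_peirceOne, hy, φ.apply_symm_apply]⟩
  · intro j k hjk z
    have h := congrArg φ (he.orthogonal hjk (φ.symm z))
    rwa [hφ.map_triple, φ.apply_symm_apply, map_zero] at h
  · rw [← map_sum, he.sum_eq]

theorem IsTripleAut.metric_map (hφ : IsTripleAut φ) {r : ℕ} {a u v : H →L[ℂ] H}
    (ha : a ∈ Mr H r) (ha' : φ a ∈ Mr H r) (hu : u ∈ halfSpace a) (hv : v ∈ halfSpace a) :
    metric r (φ a) (φ u) (φ v) = metric r a u v := by
  obtain ⟨α, hα, rfl⟩ := exists_orthonormal_of_mem_Mr ha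
  have he := isFrame_rankOne hα
  rw [metric_eq_frameForm he hu hv, metric_eq_frameForm (hφ.isFrame_map he ha'.1)
    (hφ.map_mem_halfSpace hu) (hφ.map_mem_halfSpace hv), frameForm, frameForm]
  congr 1
  refine Finset.sum_congr rfl fun k _ => ?_
  rw [← hφ.map_peirceHalf, ← hφ.map_peirceHalf, hφ.leviForm_map (he.minimal k).2.1]

/-! ### Derivatives of curves of operators and vectors -/

omit [CompleteSpace H] in
theorem hasDerivWithinAt_apply {γ : ℝ → H →L[ℂ] H} {γ' : H →L[ℂ] H} {β : ℝ → H} {β' : H}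
    {s : Set ℝ} {t : ℝ} (hγ : HasDerivWithinAt γ γ' s t) (hβ : HasDerivWithinAt β β' s t) :
    HasDerivWithinAt (fun τ => γ τ (β τ)) (γ' (β t) + γ t β') s t := by
  have h := (ContinuousLinearMap.restrictScalarsL ℂ H H ℝ ℝ).hasFDerivAt.comp_hasDerivWithinAt t hγ
  exact h.clm_apply hβ

omit [CompleteSpace H] in
theorem continuousOn_apply {γ : ℝ → H →L[ℂ] H} {β : ℝ → H} {s : Set ℝ} (hγ : ContinuousOn γ s)
    (hβ : ContinuousOn β s) : ContinuousOn (fun τ => γ τ (β τ)) s :=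
  hγ.clm_apply hβ

theorem eq_of_hasDerivWithinAt_zero {E : Type*} [NormedAddCommGroup E] [NormedSpace ℝ E]
    {f : ℝ → E} {s : Set ℝ} (hs : Convex ℝ s) (hf : ∀ t ∈ s, HasDerivWithinAt f 0 s t)
    {x y : ℝ} (hx : x ∈ s) (hy : y ∈ s) : f y = f x := by
  have h := hs.norm_image_sub_le_of_norm_hasDerivWithin_le (C := 0) hf (fun _ _ => by simp) hx hy
  rw [zero_mul] at h
  exact sub_eq_zero.1 (norm_le_zero_iff.1 h)

theorem inner_skew {A : H →L[ℂ] H} (hA : star A = -A) (x y : H) :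
    ⟪x, A y⟫_ℂ + ⟪A x, y⟫_ℂ = 0 := by
  have h : ContinuousLinearMap.adjoint A = -A := hA
  rw [← ContinuousLinearMap.adjoint_inner_right A x y, h, neg_apply, inner_neg_right,
    add_neg_cancel]

/-- Two solutions of `β' = A β` with `A` skew-adjoint have constant inner product. -/
theorem inner_eq_of_skew {A : ℝ → H →L[ℂ] H} {β δ : ℝ → H} {s : Set ℝ} (hs : Convex ℝ s)
    (hA : ∀ t ∈ s, star (A t) = -A t) (hβ : ∀ t ∈ s, HasDerivWithinAt β (A t (β t)) s t)
    (hδ : ∀ t ∈ s, HasDerivWithinAt δ (A t (δ t)) s t) {x y : ℝ} (hx : x ∈ s) (hy : y ∈ s) :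
    ⟪β y, δ y⟫_ℂ = ⟪β x, δ x⟫_ℂ := by
  refine eq_of_hasDerivWithinAt_zero (f := fun t => ⟪β t, δ t⟫_ℂ) hs (fun t ht => ?_) hx hy
  have h := (hβ t ht).inner ℂ (hδ t ht)
  rwa [inner_skew (hA t ht)] at h

theorem lipschitzWith_two_smul_div {E : Type*} [NormedAddCommGroup E] [NormedSpace ℝ E] :
    LipschitzWith 6 fun x : E => (2 / (1 + ‖x‖ ^ 2)) • x := by
  refine LipschitzWith.of_dist_le_mul fun x y => ?_
  rw [dist_eq_norm, dist_eq_norm]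
  have hx := norm_nonneg x
  have hy := norm_nonneg y
  have hN : (0 : ℝ) < 1 + ‖x‖ ^ 2 := by positivity
  have hM : (0 : ℝ) < 1 + ‖y‖ ^ 2 := by positivity
  have h1 : (2 / (1 + ‖x‖ ^ 2)) • x - (2 / (1 + ‖y‖ ^ 2)) • y =
      (2 / (1 + ‖x‖ ^ 2)) • (x - y) +
        (2 * (‖y‖ ^ 2 - ‖x‖ ^ 2) / ((1 + ‖x‖ ^ 2) * (1 + ‖y‖ ^ 2))) • y := by
    have h2 : 2 * (‖y‖ ^ 2 - ‖x‖ ^ 2) / ((1 + ‖x‖ ^ 2) * (1 + ‖y‖ ^ 2)) =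
        2 / (1 + ‖x‖ ^ 2) - 2 / (1 + ‖y‖ ^ 2) := by
      field_simp
      ring
    rw [h2]
    module
  have h3 : |‖y‖ - ‖x‖| ≤ ‖x - y‖ := by
    rw [abs_sub_comm]
    exact abs_norm_sub_norm_le x y
  have h4 : 2 / (1 + ‖x‖ ^ 2) ≤ 2 := div_le_self (by norm_num) (by nlinarith)
  have h5 : |2 * (‖y‖ ^ 2 - ‖x‖ ^ 2) / ((1 + ‖x‖ ^ 2) * (1 + ‖y‖ ^ 2))| * ‖y‖ ≤
      4 * ‖x - y‖ := by
    rw [abs_div, abs_of_pos (mul_pos hN hM), div_mul_eq_mul_div, div_le_iff₀ (mul_pos hN hM)]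
    have h6 : |2 * (‖y‖ ^ 2 - ‖x‖ ^ 2)| = 2 * (|‖y‖ - ‖x‖| * (‖y‖ + ‖x‖)) := by
      rw [abs_mul, abs_two, sq_sub_sq, abs_mul, abs_of_nonneg (add_nonneg hy hx),
        mul_comm (‖y‖ + ‖x‖)]
    rw [h6]
    have h7 : 2 * ((‖y‖ + ‖x‖) * ‖y‖) ≤ 4 * ((1 + ‖x‖ ^ 2) * (1 + ‖y‖ ^ 2)) := by
      nlinarith [sq_nonneg (‖x‖ - ‖y‖), mul_nonneg (sq_nonneg ‖x‖) (sq_nonneg ‖y‖)]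
    calc 2 * (|‖y‖ - ‖x‖| * (‖y‖ + ‖x‖)) * ‖y‖
        = |‖y‖ - ‖x‖| * (2 * ((‖y‖ + ‖x‖) * ‖y‖)) := by ring
      _ ≤ ‖x - y‖ * (4 * ((1 + ‖x‖ ^ 2) * (1 + ‖y‖ ^ 2))) :=
          mul_le_mul h3 h7 (by positivity) (norm_nonneg _)
      _ = _ := by ring
  rw [h1]
  refine (norm_add_le _ _).trans ?_
  rw [norm_smul, norm_smul, Real.norm_eq_abs, Real.norm_eq_abs, abs_of_pos (div_pos two_pos hN)]
  have h8 := mul_le_mul_of_nonneg_right h4 (norm_nonneg (x - y))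
  have h9 : ((6 : NNReal) : ℝ) = 6 := rfl
  rw [h9]
  linarith

/-- The linear equation `β' = A β` with `A` skew-adjoint is solvable on the whole interval. It is
solved with `A` replaced by the bounded Lipschitz field `x ↦ A (2 x / (1 + ‖x‖²))`; this equation
also conserves the norm, and on the unit sphere the two fields agree. -/
theorem exists_solution_of_skew {A : ℝ → H →L[ℂ] H} (hc : ContinuousOn A (Set.Icc 0 1))
    (hA : ∀ t ∈ Set.Icc (0 : ℝ) 1, star (A t) = -A t) {x : H} (hx : ‖x‖ = 1) :
    ∃ β : ℝ → H, β 0 = x ∧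
      ∀ t ∈ Set.Icc (0 : ℝ) 1, HasDerivWithinAt β (A t (β t)) (Set.Icc 0 1) t := by
  obtain ⟨K, hK⟩ := isCompact_Icc.exists_bound_of_continuousOn hc
  set ρ : H → H := fun x => (2 / (1 + ‖x‖ ^ 2)) • x with hρ
  have hρ1 : ∀ y, ‖ρ y‖ ≤ 1 := by
    intro y
    have hN : (0 : ℝ) < 1 + ‖y‖ ^ 2 := by positivity
    rw [hρ, norm_smul, Real.norm_eq_abs, abs_of_pos (div_pos two_pos hN), div_mul_eq_mul_div,
      div_le_one hN]
    nlinarith [sq_nonneg (‖y‖ - 1)]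
  have hK' : ∀ t ∈ Set.Icc (0 : ℝ) 1, ‖A t‖ ≤ K.toNNReal := fun t ht =>
    (hK t ht).trans (Real.le_coe_toNNReal K)
  have hpl : IsPicardLindelof (fun t y => A t (ρ y)) (tmin := 0) (tmax := 1)
      ⟨0, Set.left_mem_Icc.2 zero_le_one⟩ x K.toNNReal 0 K.toNNReal (K.toNNReal * 6) := by
    refine ⟨fun t ht => ?_, fun y _ => ?_, fun t ht y _ => ?_, by simp⟩
    · have h1 : LipschitzWith K.toNNReal (A t) :=
        (A t).lipschitz.weaken (hK' t ht)
      exact (h1.comp lipschitzWith_two_smul_div).lipschitzOnWith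
    · exact continuousOn_apply hc continuousOn_const
    · calc ‖A t (ρ y)‖ ≤ ‖A t‖ * ‖ρ y‖ := (A t).le_opNorm _
        _ ≤ K.toNNReal * 1 := mul_le_mul (hK' t ht) (hρ1 y) (norm_nonneg _) (NNReal.coe_nonneg _)
        _ = K.toNNReal := mul_one _
  obtain ⟨β, hβ0, hβ⟩ := hpl.exists_eq_forall_mem_Icc_hasDerivWithinAt₀
  have hβ0' : β 0 = x := hβ0
  refine ⟨β, hβ0', fun t ht => ?_⟩
  have hn : ⟪β t, β t⟫_ℂ = ⟪β 0, β 0⟫_ℂ := by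
    refine eq_of_hasDerivWithinAt_zero (f := fun t => ⟪β t, β t⟫_ℂ) (convex_Icc 0 1)
      (fun τ hτ => ?_) (Set.left_mem_Icc.2 zero_le_one) ht
    have h := (hβ τ hτ).inner ℂ (hβ τ hτ)
    have h2 : A τ (ρ (β τ)) = ((2 / (1 + ‖β τ‖ ^ 2) : ℝ) : ℂ) • A τ (β τ) := by
      rw [hρ, ← map_smul, Complex.coe_smul]
    rw [h2, inner_smul_right, inner_smul_left, Complex.conj_ofReal, ← mul_add,
      inner_skew (hA τ hτ), mul_zero] at h
    exact h
  have hn' : ‖β t‖ = 1 := by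
    rw [hβ0', inner_self_eq_norm_sq_to_K, inner_self_eq_norm_sq_to_K, hx] at hn
    have h3 : ‖β t‖ ^ 2 = 1 ^ 2 := by exact_mod_cast hn
    exact (pow_left_inj₀ (norm_nonneg _) zero_le_one two_ne_zero).1 h3
  have h := hβ t ht
  have h4 : ρ (β t) = β t := by
    rw [hρ]
    simp only [hn']
    norm_num
  simpa only [h4] using h

/-! ### Curves of projections -/

section curve

variable {γ : ℝ → H →L[ℂ] H} {s : Set ℝ} {t : ℝ} {u : H →L[ℂ] H}

/-- This follows by differentiating `γ ^ 2 = γ` and `star γ = γ`. -/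
theorem tangentAt_of_hasDerivWithinAt (hp : ∀ τ ∈ s, IsStarProjection (γ τ)) (ht : t ∈ s)
    (hs : UniqueDiffWithinAt ℝ s t) (hγ : HasDerivWithinAt γ u s t) : u ∈ tangentAt (γ t) := by
  refine ⟨(mem_halfSpace_iff (hp t ht)).2 ?_, ?_⟩
  · have h1 := hγ.mul hγ
    have h2 : HasDerivWithinAt γ (u * γ t + γ t * u) s t :=
      h1.congr (fun τ hτ => (hp τ hτ).isIdempotentElem.symm) (hp t ht).isIdempotentElem.symm
    rw [add_comm]
    exact hs.eq_deriv _ h2 hγ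
  · have h1 := hγ.star
    have h2 : HasDerivWithinAt γ (star u) s t :=
      h1.congr (fun τ hτ => (hp τ hτ).isSelfAdjoint.star_eq.symm)
        (hp t ht).isSelfAdjoint.star_eq.symm
    exact hs.eq_deriv _ h2 hγ

/-- The generator `[u, a]` of the rotation of the projection `a` with velocity `u`. -/
def generator (a u : H →L[ℂ] H) : H →L[ℂ] H := u * a - a * u

theorem star_generator {a : H →L[ℂ] H} (ha : IsStarProjection a) (hu : u ∈ tangentAt a) :
    star (generator a u) = -generator a u := by
  rw [generator, star_sub, star_mul, star_mul, ha.isSelfAdjoint.star_eq, hu.2.star_eq, neg_sub]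

/-- A curve of projections with velocity `u` at `a` satisfies `γ' = [A, γ]` with `A = [u, a]`. -/
theorem generator_mul_sub {a : H →L[ℂ] H} (ha : IsStarProjection a) (hu : u ∈ tangentAt a) :
    generator a u * a - a * generator a u = u := by
  have h1 : a * a = a := ha.isIdempotentElem
  have h2 := corner_eq_zero ha hu.1
  have h3 := (mem_halfSpace_iff ha).1 hu.1
  rw [generator, sub_mul, mul_sub, mul_assoc, h1, h2, ← mul_assoc, h2, ← mul_assoc, h1]
  conv_rhs => rw [← h3]
  abel

theorem generator_apply {a : H →L[ℂ] H} (ha : IsStarProjection a) (hu : u ∈ tangentAt a) {x : H}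
    (hx : a x = x) : generator a u x = u x := by
  have h2 := congrArg (fun z : H →L[ℂ] H => z x) (corner_eq_zero ha hu.1)
  simp only [mul_apply_eq_comp, zero_apply, hx] at h2
  simp [generator, mul_apply_eq_comp, hx, h2]

end curve

theorem sumProj_eq_of_apply_eq {r : ℕ} {a : H →L[ℂ] H} (ha : a ∈ Mr H r) {β : Fin r → H}
    (hβ : Orthonormal ℂ β) (h : ∀ k, a (β k) = β k) : sumProj β = a := by
  have := finiteDimensional_range ha
  have hle : (sumProj β : H →ₗ[ℂ] H).range ≤ (a : H →ₗ[ℂ] H).range := by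
    rw [range_sumProj hβ, Submodule.span_le]
    rintro _ ⟨k, rfl⟩
    exact ⟨β k, h k⟩
  have heq := Submodule.eq_of_le_of_finrank_eq hle
    ((finrank_range (sumProj_mem_Mr hβ)).trans (finrank_range ha).symm)
  have h1 : sumProj β * a = a := by
    ext x
    rw [mul_apply_eq_comp]
    exact apply_of_mem_range (isStarProjection_sumProj hβ) (heq ▸ ⟨x, rfl⟩)
  have h2 : a * sumProj β = sumProj β := by
    ext x
    rw [mul_apply_eq_comp]
    exact apply_of_mem_range ha.1 (hle ⟨x, rfl⟩)
  have h3 := congrArg star h1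
  rw [star_mul, ha.1.isSelfAdjoint.star_eq, (isSelfAdjoint_sumProj β).star_eq, h2] at h3
  exact h3

/-- Horizontal lift of a curve of projections: an orthonormal basis of the initial range is
carried along by the generator of the curve to orthonormal bases of the ranges, with velocities
orthogonal to these ranges. -/
theorem exists_horizontal_lift {r : ℕ} {γ γ' : ℝ → H →L[ℂ] H}
    (hM : ∀ t ∈ Set.Icc (0 : ℝ) 1, γ t ∈ Mr H r)
    (hγ : ∀ t ∈ Set.Icc (0 : ℝ) 1, HasDerivWithinAt γ (γ' t) (Set.Icc 0 1) t)
    (hγ' : ContinuousOn γ' (Set.Icc 0 1)) {α : Fin r → H} (hα : Orthonormal ℂ α)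
    (h0 : sumProj α = γ 0) :
    ∃ β : Fin r → ℝ → H, (∀ k, β k 0 = α k) ∧
      (∀ k, ∀ t ∈ Set.Icc (0 : ℝ) 1, HasDerivWithinAt (β k) (γ' t (β k t)) (Set.Icc 0 1) t) ∧
      ∀ t ∈ Set.Icc (0 : ℝ) 1, Orthonormal ℂ (fun k => β k t) ∧
        sumProj (fun k => β k t) = γ t := by
  have hmem0 : (0 : ℝ) ∈ Set.Icc (0 : ℝ) 1 := Set.left_mem_Icc.2 zero_le_one
  have htan : ∀ t ∈ Set.Icc (0 : ℝ) 1, γ' t ∈ tangentAt (γ t) := fun t ht =>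
    tangentAt_of_hasDerivWithinAt (fun τ hτ => (hM τ hτ).1) ht
      (uniqueDiffOn_Icc zero_lt_one t ht) (hγ t ht)
  have hc : ContinuousOn (fun t => generator (γ t) (γ' t)) (Set.Icc 0 1) := by
    have hγc : ContinuousOn γ (Set.Icc 0 1) := fun t ht => (hγ t ht).continuousWithinAt
    exact (hγ'.mul hγc).sub (hγc.mul hγ')
  have hA : ∀ t ∈ Set.Icc (0 : ℝ) 1, star (generator (γ t) (γ' t)) = -generator (γ t) (γ' t) :=
    fun t ht => star_generator (hM t ht).1 (htan t ht)
  choose β hβ0 hβ using fun k => exists_solution_of_skew hc hA (hα.1 k)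
  have hon : ∀ t ∈ Set.Icc (0 : ℝ) 1, Orthonormal ℂ (fun k => β k t) := by
    intro t ht
    rw [orthonormal_iff_ite]
    intro j k
    rw [inner_eq_of_skew (convex_Icc 0 1) hA (hβ j) (hβ k) hmem0 ht, hβ0, hβ0]
    exact orthonormal_iff_ite.1 hα j k
  -- `γ β - β` solves the same equation and vanishes initially
  have hfix : ∀ k, ∀ t ∈ Set.Icc (0 : ℝ) 1, γ t (β k t) = β k t := by
    intro k t ht
    have hδ : ∀ τ ∈ Set.Icc (0 : ℝ) 1, HasDerivWithinAt (fun τ => γ τ (β k τ) - β k τ)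
        (generator (γ τ) (γ' τ) (γ τ (β k τ) - β k τ)) (Set.Icc 0 1) τ := by
      intro τ hτ
      refine ((hasDerivWithinAt_apply (hγ τ hτ) (hβ k τ hτ)).sub (hβ k τ hτ)).congr_deriv ?_
      have h := congrArg (fun z : H →L[ℂ] H => z (β k τ))
        (generator_mul_sub (hM τ hτ).1 (htan τ hτ))
      simp only [sub_apply, mul_apply_eq_comp] at h
      rw [← h, map_sub]
      abel
    have h1 := inner_eq_of_skew (convex_Icc 0 1) hA hδ hδ hmem0 ht
    simp only [hβ0] at h1
    rw [← h0, sumProj_apply_self hα, sub_self, inner_zero_left] at h1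
    exact sub_eq_zero.1 (inner_self_eq_zero.1 h1)
  refine ⟨β, hβ0, fun k t ht => ?_, fun t ht => ⟨hon t ht,
    sumProj_eq_of_apply_eq (hM t ht) (hon t ht) fun k => hfix k t ht⟩⟩
  rw [← generator_apply (hM t ht).1 (htan t ht) (hfix k t ht)]
  exact hβ k t ht

/-! ### The lower bound for lengths -/

theorem curveLength_eq {r : ℕ} {γ : ℝ → H →L[ℂ] H} {s t : ℝ} (hst : s ≤ t) {f : ℝ → ℝ}
    (hc : ContinuousOn f (Set.Icc s t)) (hf0 : ∀ τ ∈ Set.Icc s t, 0 ≤ f τ)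
    (hf : ∀ τ ∈ Set.Icc s t, tangentNorm r (γ τ) (derivWithin γ (Set.Icc s t) τ) = f τ) :
    curveLength r γ s t = ENNReal.ofReal (∫ τ in s..t, f τ) := by
  rw [intervalIntegral.integral_of_le hst, ← MeasureTheory.integral_Icc_eq_integral_Ioc,
    MeasureTheory.ofReal_integral_eq_lintegral_ofReal hc.integrableOn_Icc, curveLength]
  · exact MeasureTheory.setLIntegral_congr_fun measurableSet_Icc fun τ hτ => by rw [hf τ hτ]
  · exact (MeasureTheory.ae_restrict_iff' measurableSet_Icc).2 (Filter.Eventually.of_forall hf0)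

omit [CompleteSpace H] in
/-- Along a curve on the unit sphere the angle `arccos (Re ⟪x, y⟫)` to a unit vector `x` changes
at most with the speed of the curve. The factor `c < 1` keeps away from the points where `arccos`
is not differentiable, and does not spoil the estimate. -/
theorem arccos_deriv_le {x y y' : H} (hx : ‖x‖ = 1) (hy : ‖y‖ = 1) (hyy' : ⟪y, y'⟫_ℂ = 0)
    {c : ℝ} (hc0 : 0 ≤ c) (hc1 : c < 1) :
    -(1 / √(1 - (c * (⟪x, y⟫_ℂ).re) ^ 2)) * (c * (⟪x, y'⟫_ℂ).re) ≤ ‖y'‖ := by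
  set f := (⟪x, y⟫_ℂ).re with hf
  have hf1 : |f| ≤ 1 := by
    have := (Complex.abs_re_le_norm _).trans (norm_inner_le_norm (𝕜 := ℂ) x y)
    rwa [hx, hy, one_mul] at this
  have hf2 : f ^ 2 ≤ 1 := (sq_le_one_iff_abs_le_one f).2 hf1
  have hpos : 0 < 1 - (c * f) ^ 2 := by
    have : c ^ 2 < 1 := by nlinarith
    nlinarith [sq_nonneg c]
  have h1 : ‖x - (f : ℂ) • y‖ ^ 2 = 1 - f ^ 2 := by
    rw [norm_sub_sq (𝕜 := ℂ), inner_smul_right, norm_smul, hx, hy, RCLike.re_eq_complex_re,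
      Complex.re_ofReal_mul, ← hf, mul_one, Complex.norm_real, Real.norm_eq_abs, sq_abs]
    ring
  have h2 : |(⟪x, y'⟫_ℂ).re| ≤ ‖x - (f : ℂ) • y‖ * ‖y'‖ := by
    have h3 : ⟪x, y'⟫_ℂ = ⟪x - (f : ℂ) • y, y'⟫_ℂ := by
      rw [inner_sub_left, inner_smul_left, hyy', mul_zero, sub_zero]
    rw [h3]
    exact (Complex.abs_re_le_norm _).trans (norm_inner_le_norm _ _)
  have h4 : c * ‖x - (f : ℂ) • y‖ ≤ √(1 - (c * f) ^ 2) := by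
    refine Real.le_sqrt_of_sq_le ?_
    rw [mul_pow, h1]
    nlinarith
  have hs : 0 < √(1 - (c * f) ^ 2) := Real.sqrt_pos.2 hpos
  have h5 : -(1 / √(1 - (c * f) ^ 2)) * (c * (⟪x, y'⟫_ℂ).re) =
      (c * -(⟪x, y'⟫_ℂ).re) / √(1 - (c * f) ^ 2) := by ring
  rw [h5, div_le_iff₀ hs]
  calc c * -(⟪x, y'⟫_ℂ).re ≤ c * (‖x - (f : ℂ) • y‖ * ‖y'‖) :=
        mul_le_mul_of_nonneg_left ((neg_le_abs _).trans h2) hc0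
    _ = (c * ‖x - (f : ℂ) • y‖) * ‖y'‖ := by ring
    _ ≤ √(1 - (c * f) ^ 2) * ‖y'‖ := mul_le_mul_of_nonneg_right h4 (norm_nonneg _)
    _ = _ := mul_comm _ _

omit [CompleteSpace H] in
/-- A family of moving unit vectors with speeds `‖β k'‖` travels at least the distance
given by the angles between the initial and final vectors. -/
theorem sqrt_sum_sq_le_integral {r : ℕ} {β β' : Fin r → ℝ → H} {θ : Fin r → ℝ}
    (hθ0 : ∀ k, 0 ≤ θ k) (hθ : ∀ k, θ k ≤ Real.arccos (⟪β k 0, β k 1⟫_ℂ).re)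
    (hβ : ∀ k, ∀ t ∈ Set.Icc (0 : ℝ) 1, HasDerivWithinAt (β k) (β' k t) (Set.Icc 0 1) t)
    (hn : ∀ k, ∀ t ∈ Set.Icc (0 : ℝ) 1, ‖β k t‖ = 1)
    (ho : ∀ k, ∀ t ∈ Set.Icc (0 : ℝ) 1, ⟪β k t, β' k t⟫_ℂ = 0)
    (hc : ContinuousOn (fun t => √(∑ k, ‖β' k t‖ ^ 2)) (Set.Icc 0 1)) :
    √(∑ k, θ k ^ 2) ≤ ∫ t in (0 : ℝ)..1, √(∑ k, ‖β' k t‖ ^ 2) := by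
  set I := ∫ t in (0 : ℝ)..1, √(∑ k, ‖β' k t‖ ^ 2) with hI
  set Θ := √(∑ k, θ k ^ 2) with hΘ
  have hmem0 : (0 : ℝ) ∈ Set.Icc (0 : ℝ) 1 := Set.left_mem_Icc.2 zero_le_one
  have key : ∀ c : ℝ, 0 ≤ c → c < 1 →
      ∑ k, θ k * Real.arccos (c * (⟪β k 0, β k 1⟫_ℂ).re) - ∑ k, θ k * Real.arccos c ≤ Θ * I := by
    intro c hc0 hc1
    have hd : ∀ k, ∀ t ∈ Set.Icc (0 : ℝ) 1,
        HasDerivWithinAt (fun t => Real.arccos (c * (⟪β k 0, β k t⟫_ℂ).re))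
          (-(1 / √(1 - (c * (⟪β k 0, β k t⟫_ℂ).re) ^ 2)) * (c * (⟪β k 0, β' k t⟫_ℂ).re))
          (Set.Icc 0 1) t := by
      intro k t ht
      have h1 : HasDerivWithinAt (fun t => ⟪β k 0, β k t⟫_ℂ) ⟪β k 0, β' k t⟫_ℂ
          (Set.Icc 0 1) t := by
        simpa using (hasDerivWithinAt_const t (Set.Icc 0 1) (β k 0)).inner ℂ (hβ k t ht)
      have h2 : HasDerivWithinAt (fun t => (⟪β k 0, β k t⟫_ℂ).re) (⟪β k 0, β' k t⟫_ℂ).re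
          (Set.Icc 0 1) t := Complex.reCLM.hasFDerivAt.comp_hasDerivWithinAt t h1
      have h3 := h2.const_mul c
      have h4 : |c * (⟪β k 0, β k t⟫_ℂ).re| < 1 := by
        have h5 := (Complex.abs_re_le_norm _).trans (norm_inner_le_norm (𝕜 := ℂ) (β k 0) (β k t))
        rw [hn k 0 hmem0, hn k t ht, one_mul] at h5
        rw [abs_mul, abs_of_nonneg hc0]
        nlinarith [abs_nonneg (⟪β k 0, β k t⟫_ℂ).re]
      rw [abs_lt] at h4
      have h5 := (Real.hasDerivAt_arccos h4.1.ne' h4.2.ne).comp_hasDerivWithinAt t h3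
      exact h5
    have h1 := intervalIntegral.sub_le_integral_of_hasDeriv_right_of_le
      (g := fun t => ∑ k, θ k * Real.arccos (c * (⟪β k 0, β k t⟫_ℂ).re))
      (g' := fun t => ∑ k, θ k * (-(1 / √(1 - (c * (⟪β k 0, β k t⟫_ℂ).re) ^ 2)) *
        (c * (⟪β k 0, β' k t⟫_ℂ).re)))
      (φ := fun t => Θ * √(∑ k, ‖β' k t‖ ^ 2)) zero_le_one
      (fun t ht => (HasDerivWithinAt.fun_sum fun k _ =>
        (hd k t ht).const_mul (θ k)).continuousWithinAt)
      (fun t ht => (HasDerivWithinAt.fun_sum fun k _ =>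
        (hd k t (Set.Ioo_subset_Icc_self ht)).const_mul (θ k)).mono_of_mem_nhdsWithin
          (mem_nhdsWithin_of_mem_nhds (Icc_mem_nhds ht.1 ht.2)))
      (hc.const_mul Θ).integrableOn_Icc
      (fun t ht => by
        have ht' := Set.Ioo_subset_Icc_self ht
        refine le_trans (Finset.sum_le_sum fun k _ => mul_le_mul_of_nonneg_left
          (arccos_deriv_le (hn k 0 hmem0) (hn k t ht') (ho k t ht') hc0 hc1) (hθ0 k)) ?_
        exact Real.sum_mul_le_sqrt_mul_sqrt _ _ _)
    rw [intervalIntegral.integral_const_mul] at h1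
    simpa [hn _ 0 hmem0] using h1
  have hlim : ∑ k, θ k * Real.arccos (⟪β k 0, β k 1⟫_ℂ).re ≤ Θ * I := by
    have hcont : Continuous fun c : ℝ => ∑ k, θ k * Real.arccos (c * (⟪β k 0, β k 1⟫_ℂ).re) -
        ∑ k, θ k * Real.arccos c := by
      have := Real.continuous_arccos
      fun_prop
    have h1 := (hcont.tendsto 1).mono_left (nhdsWithin_le_nhds (s := Set.Iio 1))
    have h2 : ∀ᶠ c in nhdsWithin (1 : ℝ) (Set.Iio 1),
        ∑ k, θ k * Real.arccos (c * (⟪β k 0, β k 1⟫_ℂ).re) - ∑ k, θ k * Real.arccos c ≤ Θ * I := by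
      filter_upwards [Ioo_mem_nhdsLT (show (0 : ℝ) < 1 from zero_lt_one)] with c hc
      exact key c hc.1.le hc.2
    simpa using le_of_tendsto h1 h2
  have hsq : Θ * Θ ≤ Θ * I := by
    rw [hΘ, Real.mul_self_sqrt (Finset.sum_nonneg fun k _ => sq_nonneg _), ← hΘ]
    refine le_trans (Finset.sum_le_sum fun k _ => ?_) hlim
    rw [sq]
    exact mul_le_mul_of_nonneg_left (hθ k) (hθ0 k)
  rcases (Real.sqrt_nonneg (∑ k, θ k ^ 2)).eq_or_lt with h0 | h0
  · rw [hΘ, ← h0, hI]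
    exact intervalIntegral.integral_nonneg zero_le_one fun t _ => Real.sqrt_nonneg _
  · exact le_of_mul_le_mul_left hsq h0

/-- The length of a curve in `M_r` is bounded below by the angles between the vectors of any
orthonormal basis of the initial range and the final range. -/
theorem le_curveLength {r : ℕ} {γ : ℝ → H →L[ℂ] H} (hγ : ContDiffOn ℝ 1 γ (Set.Icc 0 1))
    (hM : ∀ t ∈ Set.Icc (0 : ℝ) 1, γ t ∈ Mr H r) {α : Fin r → H} (hα : Orthonormal ℂ α)
    (h0 : sumProj α = γ 0) :
    ENNReal.ofReal (1 / √(r : ℝ) * √(∑ k, Real.arccos ‖γ 1 (α k)‖ ^ 2)) ≤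
      curveLength r γ 0 1 := by
  have hmem0 : (0 : ℝ) ∈ Set.Icc (0 : ℝ) 1 := Set.left_mem_Icc.2 zero_le_one
  have hmem1 : (1 : ℝ) ∈ Set.Icc (0 : ℝ) 1 := Set.right_mem_Icc.2 zero_le_one
  have hu : UniqueDiffOn ℝ (Set.Icc (0 : ℝ) 1) := uniqueDiffOn_Icc zero_lt_one
  set γ' := derivWithin γ (Set.Icc 0 1) with hγ'
  have hd : ∀ t ∈ Set.Icc (0 : ℝ) 1, HasDerivWithinAt γ (γ' t) (Set.Icc 0 1) t := fun t ht =>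
    (hγ.differentiableOn one_ne_zero t ht).hasDerivWithinAt
  have hc : ContinuousOn γ' (Set.Icc 0 1) := hγ.continuousOn_derivWithin hu le_rfl
  have htan : ∀ t ∈ Set.Icc (0 : ℝ) 1, γ' t ∈ tangentAt (γ t) := fun t ht =>
    tangentAt_of_hasDerivWithinAt (fun τ hτ => (hM τ hτ).1) ht (hu t ht) (hd t ht)
  obtain ⟨β, hβ0, hβ, hβo⟩ := exists_horizontal_lift hM hd hc hα h0
  have hβc : ∀ k, ContinuousOn (β k) (Set.Icc 0 1) := fun k t ht =>
    (hβ k t ht).continuousWithinAt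
  have hfix : ∀ t ∈ Set.Icc (0 : ℝ) 1, ∀ k, γ t (β k t) = β k t := by
    intro t ht k
    rw [← (hβo t ht).2]
    exact sumProj_apply_self (hβo t ht).1 k
  have hsc : ContinuousOn (fun t => √(∑ k, ‖γ' t (β k t)‖ ^ 2)) (Set.Icc 0 1) := by
    refine Real.continuous_sqrt.comp_continuousOn (continuousOn_finsetSum _ fun k _ => ?_)
    exact (continuousOn_apply hc (hβc k)).norm.pow 2
  rw [curveLength_eq zero_le_one (hsc.const_mul (1 / √(r : ℝ))) (fun t _ => by positivity)
    (fun t ht => ?_), intervalIntegral.integral_const_mul]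
  · refine ENNReal.ofReal_le_ofReal (mul_le_mul_of_nonneg_left ?_ (by positivity))
    refine sqrt_sum_sq_le_integral (β' := fun k t => γ' t (β k t))
      (fun k => Real.arccos_nonneg _) (fun k => ?_) hβ (fun k t ht => (hβo t ht).1.1 k)
      (fun k t ht => ?_) hsc
    · refine Real.arccos_le_arccos ((Complex.re_le_norm _).trans ?_)
      rw [hβ0, ← hfix 1 hmem1 k, ← inner_apply_comm (hM 1 hmem1).1.isSelfAdjoint]
      have := norm_inner_le_norm (𝕜 := ℂ) (γ 1 (α k)) (β k 1)
      rwa [(hβo 1 hmem1).1.1 k, mul_one] at this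
    · have h := congrArg (fun z : H →L[ℂ] H => ⟪β k t, z (β k t)⟫_ℂ)
        (corner_eq_zero (hM t ht).1 (htan t ht).1)
      simpa [mul_apply_eq_comp, ← inner_apply_comm (hM t ht).1.isSelfAdjoint, hfix t ht k] using h
  · have h := tangentNorm_eq (hβo t ht).1 (u := γ' t) (by rw [(hβo t ht).2]; exact htan t ht)
    rwa [(hβo t ht).2] at h

theorem le_riemannDist {r : ℕ} {a b : H →L[ℂ] H} {α : Fin r → H} (hα : Orthonormal ℂ α)
    (ha : sumProj α = a) :
    ENNReal.ofReal (1 / √(r : ℝ) * √(∑ k, Real.arccos ‖b (α k)‖ ^ 2)) ≤ riemannDist r a b := by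
  refine le_iInf₂ fun γ hγ => ?_
  have h := le_curveLength hγ.1 hγ.2.1 hα (ha.trans hγ.2.2.1.symm)
  rwa [hγ.2.2.2] at h

/-! ### Standard geodesics -/

/-- Data of a simultaneous rotation by angles `θ k`: an orthonormal family `α` and pairwise
orthogonal vectors `ξ k` orthogonal to it, of norm one, or zero where `θ k = 0`. -/
structure IsRotationData {r : ℕ} (α ξ : Fin r → H) (θ : Fin r → ℝ) : Prop where
  orthonormal : Orthonormal ℂ α
  inner_eq_zero : ∀ j k, ⟪α j, ξ k⟫_ℂ = 0
  orthogonal : Pairwise fun j k => ⟪ξ j, ξ k⟫_ℂ = 0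
  norm_eq : ∀ k, ‖ξ k‖ = 1 ∨ ξ k = 0 ∧ θ k = 0

/-- The vectors `α k` rotated towards `ξ k` by the angle `t θ k`. -/
def rotate {r : ℕ} (α ξ : Fin r → H) (θ : Fin r → ℝ) (t : ℝ) (k : Fin r) : H :=
  (Real.cos (t * θ k) : ℂ) • α k + (Real.sin (t * θ k) : ℂ) • ξ k

/-- The velocities of the vectors `rotate α ξ θ t k`. -/
def rotateDeriv {r : ℕ} (α ξ : Fin r → H) (θ : Fin r → ℝ) (t : ℝ) (k : Fin r) : H :=
  (-(θ k * Real.sin (t * θ k) : ℝ) : ℂ) • α k + ((θ k * Real.cos (t * θ k) : ℝ) : ℂ) • ξ k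

/-- The derivative of the curve `t ↦ sumProj (rotate α ξ θ t)`, in double angles. -/
def rotateVel {r : ℕ} (α ξ : Fin r → H) (θ : Fin r → ℝ) (t : ℝ) : H →L[ℂ] H :=
  ∑ k, ((-(θ k * Real.sin (2 * (t * θ k)))) •
      (InnerProductSpace.rankOne ℂ (α k) (α k) - InnerProductSpace.rankOne ℂ (ξ k) (ξ k)) +
    (θ k * Real.cos (2 * (t * θ k))) •
      (InnerProductSpace.rankOne ℂ (α k) (ξ k) + InnerProductSpace.rankOne ℂ (ξ k) (α k)))

/-- The second derivative of the curve `t ↦ sumProj (rotate α ξ θ t)`, in double angles. -/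
def rotateAcc {r : ℕ} (α ξ : Fin r → H) (θ : Fin r → ℝ) (t : ℝ) : H →L[ℂ] H :=
  ∑ k, ((-(2 * θ k ^ 2 * Real.cos (2 * (t * θ k)))) •
      (InnerProductSpace.rankOne ℂ (α k) (α k) - InnerProductSpace.rankOne ℂ (ξ k) (ξ k)) +
    (-(2 * θ k ^ 2 * Real.sin (2 * (t * θ k)))) •
      (InnerProductSpace.rankOne ℂ (α k) (ξ k) + InnerProductSpace.rankOne ℂ (ξ k) (α k)))

/-- In double angles the curve is a trigonometric polynomial of degree one with constant operator
coefficients, which makes its derivatives immediate. -/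
theorem sumProj_rotate {r : ℕ} (α ξ : Fin r → H) (θ : Fin r → ℝ) (t : ℝ) :
    sumProj (rotate α ξ θ t) = ∑ k, ((1 / 2 : ℝ) •
      (InnerProductSpace.rankOne ℂ (α k) (α k) + InnerProductSpace.rankOne ℂ (ξ k) (ξ k)) +
      ((1 / 2 * Real.cos (2 * (t * θ k))) •
        (InnerProductSpace.rankOne ℂ (α k) (α k) - InnerProductSpace.rankOne ℂ (ξ k) (ξ k)) +
      (1 / 2 * Real.sin (2 * (t * θ k))) •
        (InnerProductSpace.rankOne ℂ (α k) (ξ k) + InnerProductSpace.rankOne ℂ (ξ k) (α k)))) := by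
  rw [sumProj]
  refine Finset.sum_congr rfl fun k _ => ?_
  have h1 := Real.cos_sq' (t * θ k)
  rw [rotate, Real.cos_two_mul, Real.sin_two_mul]
  generalize Real.cos (t * θ k) = c at h1 ⊢
  generalize Real.sin (t * θ k) = s at h1 ⊢
  have h2 : (c : ℂ) ^ 2 = 1 - (s : ℂ) ^ 2 := by exact_mod_cast h1
  simp only [← Complex.coe_smul, map_add, map_smul, map_smulₛₗ, add_apply, smul_apply,
    Complex.conj_ofReal]
  push_cast
  match_scalars <;> first | ring1 | linear_combination h2

theorem hasDerivAt_sumProj_rotate {r : ℕ} (α ξ : Fin r → H) (θ : Fin r → ℝ) (t : ℝ) :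
    HasDerivAt (fun t => sumProj (rotate α ξ θ t)) (rotateVel α ξ θ t) t := by
  simp only [sumProj_rotate]
  refine HasDerivAt.fun_sum fun k _ => ?_
  have h0 : HasDerivAt (fun t : ℝ => 2 * (t * θ k)) (2 * θ k) t := by
    simpa using ((hasDerivAt_id t).mul_const (θ k)).const_mul 2
  have hc := (h0.cos.const_mul (1 / 2)).smul_const
    (InnerProductSpace.rankOne ℂ (α k) (α k) - InnerProductSpace.rankOne ℂ (ξ k) (ξ k))
  have hs := (h0.sin.const_mul (1 / 2)).smul_const
    (InnerProductSpace.rankOne ℂ (α k) (ξ k) + InnerProductSpace.rankOne ℂ (ξ k) (α k))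
  refine ((hc.add hs).const_add _).congr_deriv ?_
  congr 2 <;> ring

omit [CompleteSpace H] in
theorem hasDerivAt_rotateVel {r : ℕ} (α ξ : Fin r → H) (θ : Fin r → ℝ) (t : ℝ) :
    HasDerivAt (rotateVel α ξ θ) (rotateAcc α ξ θ t) t := by
  refine HasDerivAt.fun_sum fun k _ => ?_
  have h0 : HasDerivAt (fun t : ℝ => 2 * (t * θ k)) (2 * θ k) t := by
    simpa using ((hasDerivAt_id t).mul_const (θ k)).const_mul 2
  have hs := ((h0.sin.const_mul (θ k)).neg).smul_const
    (InnerProductSpace.rankOne ℂ (α k) (α k) - InnerProductSpace.rankOne ℂ (ξ k) (ξ k))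
  have hc := (h0.cos.const_mul (θ k)).smul_const
    (InnerProductSpace.rankOne ℂ (α k) (ξ k) + InnerProductSpace.rankOne ℂ (ξ k) (α k))
  refine (hs.add hc).congr_deriv ?_
  congr 2 <;> ring

theorem contDiff_sumProj_rotate {r : ℕ} (α ξ : Fin r → H) (θ : Fin r → ℝ) {n : WithTop ℕ∞} :
    ContDiff ℝ n fun t => sumProj (rotate α ξ θ t) := by
  simp only [sumProj_rotate]
  refine ContDiff.sum fun k _ => ?_
  have h0 : ContDiff ℝ n fun t : ℝ => 2 * (t * θ k) := by fun_prop
  exact contDiff_const.add (((contDiff_const.mul h0.cos).smul contDiff_const).add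
    ((contDiff_const.mul h0.sin).smul contDiff_const))

namespace IsRotationData

variable {r : ℕ} {α ξ : Fin r → H} {θ : Fin r → ℝ}

omit [CompleteSpace H] in
theorem inner_eq_zero' (h : IsRotationData α ξ θ) (j k : Fin r) : ⟪ξ j, α k⟫_ℂ = 0 :=
  inner_eq_zero_symm.1 (h.inner_eq_zero k j)

omit [CompleteSpace H] in
theorem inner_rotate (h : IsRotationData α ξ θ) (j k : Fin r) (a b c d : ℝ) :
    ⟪(a : ℂ) • α j + (b : ℂ) • ξ j, (c : ℂ) • α k + (d : ℂ) • ξ k⟫_ℂ =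
      if j = k then ((a * c + b * d * ‖ξ k‖ ^ 2 : ℝ) : ℂ) else 0 := by
  simp only [inner_add_left, inner_add_right, inner_smul_left, inner_smul_right,
    Complex.conj_ofReal, h.inner_eq_zero, h.inner_eq_zero', orthonormal_iff_ite.1 h.orthonormal]
  split_ifs with hjk
  · subst hjk
    rw [inner_self_eq_norm_sq_to_K]
    push_cast
    simp
    ring
  · rw [h.orthogonal hjk]
    simp

omit [CompleteSpace H] in
theorem orthonormal_rotate (h : IsRotationData α ξ θ) (t : ℝ) :
    Orthonormal ℂ (rotate α ξ θ t) := by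
  rw [orthonormal_iff_ite]
  intro j k
  rw [rotate, rotate, h.inner_rotate]
  split_ifs with hjk
  · subst hjk
    rcases h.norm_eq j with h1 | h1
    · rw [h1, ← Complex.ofReal_one]
      congr 1
      linear_combination Real.sin_sq_add_cos_sq (t * θ j)
    · simp [h1]
  · rfl

omit [CompleteSpace H] in
theorem norm_rotateDeriv_sq (h : IsRotationData α ξ θ) (t : ℝ) (k : Fin r) :
    ‖rotateDeriv α ξ θ t k‖ ^ 2 = θ k ^ 2 := by
  have h1 : ((‖rotateDeriv α ξ θ t k‖ ^ 2 : ℝ) : ℂ) = ((θ k ^ 2 : ℝ) : ℂ) := by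
    have h2 := inner_self_eq_norm_sq_to_K (𝕜 := ℂ) (rotateDeriv α ξ θ t k)
    rw [rotateDeriv, ← Complex.ofReal_neg, h.inner_rotate, if_pos rfl] at h2
    rw [rotateDeriv, ← Complex.ofReal_neg]
    rw [Complex.ofReal_pow]
    refine h2.symm.trans ?_
    rcases h.norm_eq k with h1 | h1
    · rw [h1]
      norm_cast
      linear_combination θ k ^ 2 * Real.sin_sq_add_cos_sq (t * θ k)
    · simp [h1]
  exact_mod_cast h1

omit [CompleteSpace H] in
theorem inner_left_rotate (h : IsRotationData α ξ θ) (t : ℝ) (j k : Fin r) :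
    ⟪α j, rotate α ξ θ t k⟫_ℂ = if j = k then (Real.cos (t * θ k) : ℂ) else 0 := by
  have h1 := h.inner_rotate j k 1 0 (Real.cos (t * θ k)) (Real.sin (t * θ k))
  simp only [Complex.ofReal_one, one_smul, Complex.ofReal_zero, zero_smul, add_zero, one_mul,
    zero_mul] at h1
  exact h1

omit [CompleteSpace H] in
theorem inner_right_rotate (h : IsRotationData α ξ θ) (t : ℝ) (j k : Fin r) :
    ⟪ξ j, rotate α ξ θ t k⟫_ℂ =
      if j = k then ((Real.sin (t * θ k) * ‖ξ k‖ ^ 2 : ℝ) : ℂ) else 0 := by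
  have h1 := h.inner_rotate j k 0 1 (Real.cos (t * θ k)) (Real.sin (t * θ k))
  simp only [Complex.ofReal_one, one_smul, Complex.ofReal_zero, zero_smul, zero_add, one_mul,
    zero_mul] at h1
  exact h1

omit [CompleteSpace H] in
theorem rotateVel_apply (h : IsRotationData α ξ θ) (t : ℝ) (k : Fin r) :
    rotateVel α ξ θ t (rotate α ξ θ t k) = rotateDeriv α ξ θ t k := by
  rw [rotateVel, sum_apply, Finset.sum_eq_single_of_mem k (Finset.mem_univ k)]
  · simp only [add_apply, smul_apply, sub_apply, InnerProductSpace.rankOne_apply,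
      h.inner_left_rotate, h.inner_right_rotate, if_true, rotateDeriv]
    rcases h.norm_eq k with h1 | h1
    · rw [h1, Real.cos_two_mul, Real.sin_two_mul]
      have h2 := Real.cos_sq' (t * θ k)
      generalize Real.cos (t * θ k) = c at h2 ⊢
      generalize Real.sin (t * θ k) = s at h2 ⊢
      have h3 : (c : ℂ) ^ 2 = 1 - (s : ℂ) ^ 2 := by exact_mod_cast h2
      simp only [← Complex.coe_smul]
      push_cast
      match_scalars
      · ring
      · linear_combination 2 * θ k * c * h3
    · simp [h1]
  · intro j _ hjk
    simp [h.inner_left_rotate, h.inner_right_rotate, hjk]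

omit [CompleteSpace H] in
theorem rotateAcc_apply (h : IsRotationData α ξ θ) (t : ℝ) (k : Fin r) :
    rotateAcc α ξ θ t (rotate α ξ θ t k) = (-(2 * θ k ^ 2 : ℝ) : ℂ) • rotate α ξ θ t k := by
  rw [rotateAcc, sum_apply, Finset.sum_eq_single_of_mem k (Finset.mem_univ k)]
  · simp only [add_apply, smul_apply, sub_apply, InnerProductSpace.rankOne_apply,
      h.inner_left_rotate, h.inner_right_rotate, if_true]
    rcases h.norm_eq k with h1 | h1
    · rw [h1, Real.cos_two_mul, Real.sin_two_mul, rotate]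
      have h2 := Real.cos_sq' (t * θ k)
      generalize Real.cos (t * θ k) = c at h2 ⊢
      generalize Real.sin (t * θ k) = s at h2 ⊢
      have h3 : (c : ℂ) ^ 2 = 1 - (s : ℂ) ^ 2 := by exact_mod_cast h2
      simp only [← Complex.coe_smul]
      push_cast
      match_scalars
      · linear_combination -4 * θ k ^ 2 * c * h3
      · ring
    · simp [h1]
  · intro j _ hjk
    simp [h.inner_left_rotate, h.inner_right_rotate, hjk]

theorem sumProj_rotate_mem (h : IsRotationData α ξ θ) (t : ℝ) :
    sumProj (rotate α ξ θ t) ∈ Mr H r := sumProj_mem_Mr (h.orthonormal_rotate t)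

theorem isGeodesicOn (h : IsRotationData α ξ θ) :
    IsGeodesicOn r Set.univ fun t => sumProj (rotate α ξ θ t) := by
  refine ⟨(contDiff_sumProj_rotate α ξ θ).contDiffOn, fun t _ => h.sumProj_rotate_mem t,
    fun t _ => ?_⟩
  have h1 : derivWithin (fun t => sumProj (rotate α ξ θ t)) Set.univ = rotateVel α ξ θ := by
    rw [derivWithin_univ]
    exact funext fun t => (hasDerivAt_sumProj_rotate α ξ θ t).deriv
  have hp := (h.sumProj_rotate_mem t).1
  rw [covDeriv, h1, derivWithin_univ, (hasDerivAt_rotateVel α ξ θ t).deriv, peirceHalf_eq hp]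
  set p := sumProj (rotate α ξ θ t) with hpdef
  have hs : star (rotateAcc α ξ θ t) = rotateAcc α ξ θ t := by
    simp only [rotateAcc, star_sum, star_add, star_smul, star_sub, star_rankOne, star_trivial]
    refine Finset.sum_congr rfl fun k _ => ?_
    rw [add_comm (InnerProductSpace.rankOne ℂ (ξ k) (α k))]
  -- the acceleration maps the range of `p` to itself
  have h2 : p * rotateAcc α ξ θ t * p = rotateAcc α ξ θ t * p := by
    ext x
    simp only [mul_apply_eq_comp, hpdef]
    rw [sumProj_apply (rotate α ξ θ t) x]
    simp only [map_sum, map_smul, h.rotateAcc_apply, sumProj_apply_self (h.orthonormal_rotate t)]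
  have h3 : p * rotateAcc α ξ θ t * p = p * rotateAcc α ξ θ t := by
    have := congrArg star h2
    rwa [star_mul, star_mul, star_mul, hs, hp.isSelfAdjoint.star_eq, ← mul_assoc] at this
  rw [h2, ← h3, h2, two_smul, sub_self]

theorem tangentNorm_eq (h : IsRotationData α ξ θ) (t : ℝ) :
    tangentNorm r (sumProj (rotate α ξ θ t)) (rotateVel α ξ θ t) =
      1 / √(r : ℝ) * √(∑ k, θ k ^ 2) := by
  have htan : rotateVel α ξ θ t ∈ tangentAt (sumProj (rotate α ξ θ t)) :=
    tangentAt_of_hasDerivWithinAt (s := Set.univ) (γ := fun t => sumProj (rotate α ξ θ t))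
      (fun τ _ => (h.sumProj_rotate_mem τ).1) (Set.mem_univ t) uniqueDiffWithinAt_univ
      (hasDerivAt_sumProj_rotate α ξ θ t).hasDerivWithinAt
  rw [FiniteRankProj.tangentNorm_eq (h.orthonormal_rotate t) htan]
  simp only [h.rotateVel_apply, h.norm_rotateDeriv_sq]

theorem curveLength_eq (h : IsRotationData α ξ θ) :
    curveLength r (fun t => sumProj (rotate α ξ θ t)) 0 1 =
      ENNReal.ofReal (1 / √(r : ℝ) * √(∑ k, θ k ^ 2)) := by
  rw [FiniteRankProj.curveLength_eq zero_le_one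
    (continuousOn_const (c := 1 / √(r : ℝ) * √(∑ k, θ k ^ 2))) (fun _ _ => by positivity)]
  · simp
  · intro t ht
    rw [((hasDerivAt_sumProj_rotate α ξ θ t).hasDerivWithinAt).derivWithin
      (uniqueDiffOn_Icc zero_lt_one t ht), h.tangentNorm_eq]

omit [CompleteSpace H] in
theorem rotate_zero : rotate α ξ θ 0 = α := by
  ext k
  simp [rotate]

omit [CompleteSpace H] in
theorem sumProj_rotate_one_apply (h : IsRotationData α ξ θ) (k : Fin r) :
    sumProj (rotate α ξ θ 1) (α k) = (Real.cos (θ k) : ℂ) • rotate α ξ θ 1 k := by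
  rw [sumProj_apply]
  have h1 : ∀ j, ⟪rotate α ξ θ 1 j, α k⟫_ℂ = if j = k then (Real.cos (θ k) : ℂ) else 0 := by
    intro j
    have h2 := h.inner_rotate j k (Real.cos (1 * θ j)) (Real.sin (1 * θ j)) 1 0
    simp only [Complex.ofReal_one, one_smul, Complex.ofReal_zero, zero_smul, add_zero, mul_one,
      mul_zero, zero_mul, one_mul] at h2
    rw [rotate, one_mul, h2]
    split_ifs with hjk
    · rw [hjk]
    · rfl
  simp [h1]

/-- For angles in `[0, π/2]` the rotation is a shortest curve between its end points. -/
theorem riemannDist_eq (h : IsRotationData α ξ θ) (hθ : ∀ k, θ k ∈ Set.Icc 0 (Real.pi / 2)) :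
    riemannDist r (sumProj α) (sumProj (rotate α ξ θ 1)) =
      ENNReal.ofReal (1 / √(r : ℝ) * √(∑ k, θ k ^ 2)) := by
  apply le_antisymm
  · rw [← h.curveLength_eq]
    refine iInf₂_le (fun t => sumProj (rotate α ξ θ t))
      ⟨(contDiff_sumProj_rotate α ξ θ).contDiffOn, fun t _ => h.sumProj_rotate_mem t, ?_, rfl⟩
    simp only [rotate_zero]
  · have h1 := le_riemannDist (b := sumProj (rotate α ξ θ 1)) h.orthonormal rfl
    have h2 : ∀ k, Real.arccos ‖sumProj (rotate α ξ θ 1) (α k)‖ = θ k := by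
      intro k
      have h3 : 0 ≤ Real.cos (θ k) := Real.cos_nonneg_of_mem_Icc
        ⟨by linarith [(hθ k).1, Real.pi_pos], (hθ k).2⟩
      rw [h.sumProj_rotate_one_apply, norm_smul, (h.orthonormal_rotate 1).1, mul_one,
        Complex.norm_real, Real.norm_eq_abs, abs_of_nonneg h3,
        Real.arccos_cos (hθ k).1 (by linarith [(hθ k).2, Real.pi_pos])]
    simpa only [h2] using h1

end IsRotationData

/-! ### Geodesics with given initial velocity -/

/-- The compression of a self-adjoint operator to the range of a finite rank projection can be
diagonalized. -/
theorem exists_orthonormal_diagonal {r : ℕ} {a T : H →L[ℂ] H} (ha : a ∈ Mr H r)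
    (hT : IsSelfAdjoint T) : ∃ α : Fin r → H, Orthonormal ℂ α ∧ sumProj α = a ∧
      Pairwise fun j k => ⟪α j, T (α k)⟫_ℂ = 0 := by
  have := finiteDimensional_range ha
  set R := (a : H →ₗ[ℂ] H).range
  -- the compression of `T` to the range `R` of `a`
  let S : R →ₗ[ℂ] R := (a * T : H →ₗ[ℂ] H).restrict (p := R) (q := R) fun x _ => ⟨T x, rfl⟩
  have hSapp : ∀ x : R, ((S x : R) : H) = a (T x) := fun x => rfl
  have hS : S.IsSymmetric := by
    intro x y
    rw [Submodule.coe_inner, Submodule.coe_inner, hSapp, hSapp,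
      inner_apply_comm ha.1.isSelfAdjoint, ← inner_apply_comm ha.1.isSelfAdjoint (x : H),
      apply_of_mem_range ha.1 x.2, apply_of_mem_range ha.1 y.2, inner_apply_comm hT]
  obtain ⟨h1, h2⟩ := sumProj_orthonormalBasis ha (hS.eigenvectorBasis (finrank_range ha))
  refine ⟨_, h1, h2, fun j k hjk => ?_⟩
  have h3 := hS.apply_eigenvectorBasis (finrank_range ha) k
  rw [Subtype.ext_iff, hSapp] at h3
  show ⟪((hS.eigenvectorBasis (finrank_range ha) j : R) : H), _⟫_ℂ = 0
  rw [← apply_of_mem_range ha.1 (hS.eigenvectorBasis (finrank_range ha) j).2,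
    inner_apply_comm ha.1.isSelfAdjoint, h3, Submodule.coe_smul, inner_smul_right, h1.2 hjk,
    mul_zero]

/-- Singular value decomposition of a tangent vector `u` at `a`: it is the initial velocity of a
rotation, by its singular values. -/
theorem exists_isRotationData_velocity {r : ℕ} {a u : H →L[ℂ] H} (ha : a ∈ Mr H r)
    (hu : u ∈ tangentAt a) : ∃ (α ξ : Fin r → H) (σ : Fin r → ℝ), IsRotationData α ξ σ ∧
      sumProj α = a ∧ rotateVel α ξ σ 0 = u ∧ ∀ k, σ k ∈ Set.Icc 0 ‖u‖ := by
  have huu : IsSelfAdjoint (u * u) := by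
    rw [IsSelfAdjoint, star_mul, hu.2.star_eq]
  obtain ⟨α, hα, rfl, hd⟩ := exists_orthonormal_diagonal ha huu
  have hp := isStarProjection_sumProj hα
  have hd' : ∀ j k, j ≠ k → ⟪u (α j), u (α k)⟫_ℂ = 0 := fun j k hjk => by
    rw [inner_apply_comm hu.2]
    exact hd hjk
  have hu0 : ∀ j k, ⟪α j, u (α k)⟫_ℂ = 0 := by
    intro j k
    have h := congrArg (fun z : H →L[ℂ] H => ⟪α j, z (α k)⟫_ℂ) (corner_eq_zero hp hu.1)
    simpa [mul_apply_eq_comp, ← inner_apply_comm hp.isSelfAdjoint, sumProj_apply_self hα] using h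
  have hσ : ∀ k, ((‖u (α k)‖ : ℝ) : ℂ) • (((‖u (α k)‖⁻¹ : ℝ) : ℂ) • u (α k)) = u (α k) := by
    intro k
    rcases eq_or_ne (u (α k)) 0 with h | h
    · simp [h]
    · rw [smul_smul, ← Complex.ofReal_mul, mul_inv_cancel₀ (norm_ne_zero_iff.2 h),
        Complex.ofReal_one, one_smul]
  -- where `u (α k) = 0`, the inverse of the norm is zero and so is the vector `ξ k`
  refine ⟨α, fun k => ((‖u (α k)‖⁻¹ : ℝ) : ℂ) • u (α k), fun k => ‖u (α k)‖,
    ⟨hα, fun j k => ?_, fun j k hjk => ?_, fun k => ?_⟩, rfl, ?_, fun k => ⟨norm_nonneg _, ?_⟩⟩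
  · rw [inner_smul_right, hu0, mul_zero]
  · simp only [inner_smul_right, inner_smul_left, hd' j k hjk, mul_zero]
  · rcases eq_or_ne (u (α k)) 0 with h | h
    · exact Or.inr (by simp [h])
    · left
      simp [norm_smul, h]
  · have h1 : rotateVel α (fun k => ((‖u (α k)‖⁻¹ : ℝ) : ℂ) • u (α k))
        (fun k => ‖u (α k)‖) 0 = ∑ k, (InnerProductSpace.rankOne ℂ (α k) (u (α k)) +
          InnerProductSpace.rankOne ℂ (u (α k)) (α k)) := by
      rw [rotateVel]
      refine Finset.sum_congr rfl fun k _ => ?_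
      conv_rhs => rw [← hσ k]
      simp only [zero_mul, mul_zero, Real.sin_zero, Real.cos_zero, mul_one, neg_zero, zero_smul,
        zero_add, map_smulₛₗ, smul_apply, Complex.conj_ofReal, RingHom.id_apply,
        ← Complex.coe_smul, smul_add]
    rw [h1, ← (mem_halfSpace_iff hp).1 hu.1, Finset.sum_add_distrib]
    congr 1
    · ext x
      rw [mul_apply_eq_comp, (mem_halfSpace_iff hp).1 hu.1, sumProj_apply, sum_apply]
      refine Finset.sum_congr rfl fun k _ => ?_
      rw [InnerProductSpace.rankOne_apply, inner_apply_comm hu.2]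
    · ext x
      rw [mul_apply_eq_comp, (mem_halfSpace_iff hp).1 hu.1, sumProj_apply, sum_apply, map_sum]
      exact Finset.sum_congr rfl fun k _ => (map_smul u _ _).symm
  · simpa [hα.1 k] using u.le_opNorm (α k)

/-- The generator of a geodesic is constant. -/
theorem IsGeodesicOn.generator_eq {r : ℕ} {J : Set ℝ} {γ : ℝ → H →L[ℂ] H}
    (h : IsGeodesicOn r J γ) (hJ : Convex ℝ J) (hu : UniqueDiffOn ℝ J) {s t : ℝ} (hs : s ∈ J)
    (ht : t ∈ J) : generator (γ t) (derivWithin γ J t) = generator (γ s) (derivWithin γ J s) := by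
  refine eq_of_hasDerivWithinAt_zero (f := fun t => generator (γ t) (derivWithin γ J t)) hJ
    (fun τ hτ => ?_) hs ht
  have h1 : HasDerivWithinAt γ (derivWithin γ J τ) J τ :=
    (h.contDiffOn.differentiableOn two_ne_zero τ hτ).hasDerivWithinAt
  have h2 : HasDerivWithinAt (derivWithin γ J) (derivWithin (derivWithin γ J) J τ) J τ :=
    ((h.contDiffOn.derivWithin (m := 1) hu (by norm_num)).differentiableOn one_ne_zero τ
      hτ).hasDerivWithinAt
  refine ((h2.mul h1).sub (h1.mul h2)).congr_deriv ?_
  have h3 := h.covDeriv_eq τ hτ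
  have hp := (h.mem τ hτ).1
  have hpp : γ τ * γ τ = γ τ := hp.isIdempotentElem
  rw [covDeriv, peirceHalf_eq hp] at h3
  set p := γ τ
  set v := derivWithin γ J τ
  set w := derivWithin (derivWithin γ J) J τ
  have h4 := congrArg (fun z => p * z) h3
  have h5 := congrArg (fun z => z * p) h3
  simp only [mul_sub, mul_add, sub_mul, add_mul, mul_smul_comm, smul_mul_assoc, mul_zero,
    zero_mul, ← mul_assoc, hpp] at h4 h5
  simp only [mul_assoc, hpp] at h4 h5
  -- as `P_{1/2}(p) w = 0`, the acceleration `w` commutes with `p`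
  have h6 : p * w = w * p := by
    have h7 := h4.trans h5.symm
    have h8 : p * w - w * p = (p * w + p * (w * p) - (2 : ℂ) • (p * (w * p))) -
      (p * (w * p) + w * p - (2 : ℂ) • (p * (w * p))) := by abel
    exact sub_eq_zero.1 (h8.trans (sub_eq_zero.2 h7))
  rw [h6]
  abel

/-- A geodesic satisfies a linear equation with constant coefficient. -/
theorem IsGeodesicOn.hasDerivWithinAt {r : ℕ} {J : Set ℝ} {γ : ℝ → H →L[ℂ] H}
    (h : IsGeodesicOn r J γ) (hJ : Convex ℝ J) (hu : UniqueDiffOn ℝ J) {s t : ℝ} (hs : s ∈ J)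
    (ht : t ∈ J) : HasDerivWithinAt γ
      (generator (γ s) (derivWithin γ J s) * γ t - γ t * generator (γ s) (derivWithin γ J s))
      J t := by
  have h1 : HasDerivWithinAt γ (derivWithin γ J t) J t :=
    (h.contDiffOn.differentiableOn two_ne_zero t ht).hasDerivWithinAt
  have htan := tangentAt_of_hasDerivWithinAt (fun τ hτ => (h.mem τ hτ).1) ht (hu t ht) h1
  rwa [← h.generator_eq hJ hu hs ht, generator_mul_sub (h.mem t ht).1 htan]

theorem eqOn_of_hasDerivWithinAt_commutator {A : H →L[ℂ] H} {γ δ : ℝ → H →L[ℂ] H} {s t : ℝ}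
    (hγ : ∀ τ ∈ Set.Icc s t, HasDerivWithinAt γ (A * γ τ - γ τ * A) (Set.Icc s t) τ)
    (hδ : ∀ τ ∈ Set.Icc s t, HasDerivWithinAt δ (A * δ τ - δ τ * A) (Set.Icc s t) τ)
    (h : γ s = δ s) : Set.EqOn γ δ (Set.Icc s t) := by
  have hlip : LipschitzWith (2 * ‖A‖₊) fun x : H →L[ℂ] H => A * x - x * A := by
    refine LipschitzWith.of_dist_le_mul fun x y => ?_
    rw [dist_eq_norm, dist_eq_norm]
    have h1 : A * x - x * A - (A * y - y * A) = A * (x - y) - (x - y) * A := by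
      rw [mul_sub, sub_mul]
      abel
    rw [h1]
    refine (norm_sub_le _ _).trans ?_
    have h2 := norm_mul_le A (x - y)
    have h3 := norm_mul_le (x - y) A
    push_cast
    linarith
  have hr : ∀ {f : ℝ → H →L[ℂ] H}, (∀ τ ∈ Set.Icc s t,
      HasDerivWithinAt f (A * f τ - f τ * A) (Set.Icc s t) τ) → ∀ τ ∈ Set.Ico s t,
      HasDerivWithinAt f (A * f τ - f τ * A) (Set.Ici τ) τ := fun hf τ hτ =>
    (hf τ (Set.Ico_subset_Icc_self hτ)).mono_of_mem_nhdsWithin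
      (Icc_mem_nhdsGE_of_mem hτ)
  exact ODE_solution_unique (v := fun _ x => A * x - x * A) (fun _ => hlip)
    (fun τ hτ => (hγ τ hτ).continuousWithinAt) (hr hγ)
    (fun τ hτ => (hδ τ hτ).continuousWithinAt) (hr hδ) h

omit [CompleteSpace H] in
theorem rotate_smul {r : ℕ} (α ξ : Fin r → H) (σ : Fin r → ℝ) (c : ℝ) :
    rotate α ξ (fun k => c * σ k) 1 = rotate α ξ σ c := by
  ext k
  simp [rotate]

/-- On each interval a geodesic is one of the standard ones. -/
theorem IsGeodesicOn.exists_eqOn {r : ℕ} {J : Set ℝ} {γ : ℝ → H →L[ℂ] H}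
    (h : IsGeodesicOn r J γ) (hJ : Convex ℝ J) (hu : UniqueDiffOn ℝ J) {s t : ℝ} (hst : s < t)
    (hsub : Set.Icc s t ⊆ J) : ∃ (α ξ : Fin r → H) (σ : Fin r → ℝ), IsRotationData α ξ σ ∧
      sumProj α = γ s ∧ (∀ k, σ k ∈ Set.Icc 0 ‖derivWithin γ J s‖) ∧
      Set.EqOn γ (fun τ => sumProj (rotate α ξ σ (τ - s))) (Set.Icc s t) := by
  have hs : s ∈ J := hsub (Set.left_mem_Icc.2 hst.le)
  have h1 : HasDerivWithinAt γ (derivWithin γ J s) J s :=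
    (h.contDiffOn.differentiableOn two_ne_zero s hs).hasDerivWithinAt
  obtain ⟨α, ξ, σ, hd, h0, hv, hσ⟩ := exists_isRotationData_velocity (h.mem s hs)
    (tangentAt_of_hasDerivWithinAt (fun τ hτ => (h.mem τ hτ).1) hs (hu s hs) h1)
  refine ⟨α, ξ, σ, hd, h0, hσ, eqOn_of_hasDerivWithinAt_commutator
    (A := generator (γ s) (derivWithin γ J s))
    (fun τ hτ => (h.hasDerivWithinAt hJ hu hs (hsub hτ)).mono hsub) (fun τ _ => ?_) ?_⟩
  · have h2 := hd.isGeodesicOn.hasDerivWithinAt convex_univ uniqueDiffOn_univ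
      (Set.mem_univ 0) (Set.mem_univ (τ - s))
    rw [derivWithin_univ, (hasDerivAt_sumProj_rotate α ξ σ 0).deriv, hv,
      IsRotationData.rotate_zero, h0, hasDerivWithinAt_univ] at h2
    exact (h2.comp_sub_const τ s).hasDerivWithinAt
  · simp only [sub_self, IsRotationData.rotate_zero, h0]

theorem IsGeodesicOn.curveLength_eq_riemannDist {r : ℕ} {J : Set ℝ} {γ : ℝ → H →L[ℂ] H}
    (hJ : J.OrdConnected) (h : IsGeodesicOn r J γ) {s t : ℝ} (hs : s ∈ J) (ht : t ∈ J)
    (hst : s ≤ t) (hle : (t - s) * ‖derivWithin γ J s‖ ≤ Real.pi / 2) :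
    curveLength r γ s t = riemannDist r (γ s) (γ t) := by
  rcases hst.eq_or_lt with rfl | hst
  -- on a single point the length vanishes, and so does the distance, as the trivial rotation shows
  · have h1 : curveLength r γ s s = 0 := by simp [curveLength]
    obtain ⟨α, hα, hα'⟩ := exists_orthonormal_of_mem_Mr (h.mem s hs)
    have hd : IsRotationData α (fun _ => 0) (fun _ => 0) :=
      ⟨hα, fun _ _ => inner_zero_right _, fun _ _ _ => inner_zero_left _,
        fun _ => Or.inr ⟨rfl, rfl⟩⟩
    have h2 := hd.riemannDist_eq fun _ => ⟨le_rfl, by positivity⟩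
    have h3 : rotate α (fun _ => 0) (fun _ => 0) 1 = α := by
      ext k
      simp [rotate]
    rw [h3, hα'] at h2
    rw [h1, h2]
    simp
  have hsub : Set.Icc s t ⊆ J := hJ.out hs ht
  have hJc : Convex ℝ J := convex_iff_ordConnected.2 hJ
  have hu : UniqueDiffOn ℝ J := uniqueDiffOn_convex hJc
    ((Set.nonempty_Ioo.2 hst).mono (by
      rw [← interior_Icc]
      exact interior_mono hsub))
  obtain ⟨α, ξ, σ, hd, h0, hσ, heq⟩ := h.exists_eqOn hJc hu hst hsub
  have hd' : IsRotationData α ξ fun k => (t - s) * σ k :=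
    ⟨hd.orthonormal, hd.inner_eq_zero, hd.orthogonal, fun k =>
      (hd.norm_eq k).imp id fun h => ⟨h.1, by rw [h.2, mul_zero]⟩⟩
  have hts : 0 < t - s := sub_pos.2 hst
  have h1 := hd'.riemannDist_eq fun k => ⟨mul_nonneg hts.le (hσ k).1,
    (mul_le_mul_of_nonneg_left (hσ k).2 hts.le).trans hle⟩
  have ht' := heq (Set.right_mem_Icc.2 hst.le)
  simp only at ht'
  rw [rotate_smul, h0, ← ht'] at h1
  rw [h1, FiniteRankProj.curveLength_eq hst.le
    (continuousOn_const (c := 1 / √(r : ℝ) * √(∑ k, σ k ^ 2))) (fun _ _ => by positivity)]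
  · congr 1
    simp only [mul_pow, ← Finset.mul_sum]
    rw [Real.sqrt_mul (sq_nonneg _), Real.sqrt_sq hts.le, intervalIntegral.integral_const,
      smul_eq_mul]
    ring
  · intro τ hτ
    have h2 := (((hasDerivAt_sumProj_rotate α ξ σ (τ - s)).comp_sub_const
      τ s).hasDerivWithinAt (s := Set.Icc s t)).congr heq (heq hτ)
    rw [h2.derivWithin (uniqueDiffOn_Icc hst τ hτ), heq hτ, hd.tangentNorm_eq]

/-! ### Principal angles -/

omit [CompleteSpace H] in
theorem inner_self_eq_ofReal (x : H) : ⟪x, x⟫_ℂ = ((‖x‖ ^ 2 : ℝ) : ℂ) := by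
  rw [inner_self_eq_norm_sq_to_K]
  push_cast
  rfl

theorem inner_apply_eq_norm_sq {b : H →L[ℂ] H} (hb : IsStarProjection b) (x : H) :
    ⟪x, b x⟫_ℂ = ((‖b x‖ ^ 2 : ℝ) : ℂ) := by
  rw [← inner_self_eq_ofReal, inner_apply_comm hb.isSelfAdjoint,
    apply_of_mem_range hb (x := b x) ⟨x, rfl⟩]

/-- Two points of `M_r` are joined by the rotation by their principal angles. The vectors `b α k`
are orthogonal; normalized and completed to an orthonormal basis of the range of `b`, they are
the end points of the rotating vectors. -/
theorem exists_isRotationData {r : ℕ} {b : H →L[ℂ] H} (hb : b ∈ Mr H r) {α : Fin r → H}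
    (hα : Orthonormal ℂ α) (hd : Pairwise fun j k => ⟪α j, b (α k)⟫_ℂ = 0) {θ : Fin r → ℝ}
    (hθ : ∀ k, θ k ∈ Set.Icc 0 (Real.pi / 2)) (hcos : ∀ k, ‖b (α k)‖ = Real.cos (θ k)) :
    ∃ ξ : Fin r → H, IsRotationData α ξ θ ∧ sumProj (rotate α ξ θ 1) = b := by
  have := finiteDimensional_range hb
  have hbb : ∀ x, b (b x) = b x := fun x => apply_of_mem_range hb.1 ⟨x, rfl⟩
  let v : Fin r → (b : H →ₗ[ℂ] H).range := fun k =>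
    ⟨((‖b (α k)‖⁻¹ : ℝ) : ℂ) • b (α k), Submodule.smul_mem _ _ ⟨α k, rfl⟩⟩
  let S : Set (Fin r) := {k | b (α k) ≠ 0}
  have hv : Orthonormal ℂ (S.domRestrict v) := by
    refine ⟨fun k => ?_, fun j k hjk => ?_⟩
    · have hk : ‖b (α k)‖ ≠ 0 := norm_ne_zero_iff.2 k.2
      show ‖((‖b (α k)‖⁻¹ : ℝ) : ℂ) • b (α k)‖ = 1
      rw [norm_smul, Complex.norm_real, norm_inv, norm_norm, inv_mul_cancel₀ hk]
    · show ⟪((‖b (α j)‖⁻¹ : ℝ) : ℂ) • b (α j), ((‖b (α k)‖⁻¹ : ℝ) : ℂ) • b (α k)⟫_ℂ = 0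
      rw [inner_smul_left, inner_smul_right, inner_apply_comm hb.1.isSelfAdjoint, hbb,
        hd (fun h => hjk (Subtype.ext h)), mul_zero, mul_zero]
  obtain ⟨B, hB⟩ := hv.exists_orthonormalBasis_extension_of_card_eq
    ((finrank_range hb).trans (Fintype.card_fin r).symm)
  obtain ⟨hβ, hβb⟩ := sumProj_orthonormalBasis hb B
  set β : Fin r → H := fun k => (B k : H) with hβdef
  have hbβ : ∀ k, b (α k) = (Real.cos (θ k) : ℂ) • β k := by
    intro k
    rw [← hcos]
    by_cases hk : b (α k) = 0
    · simp [hk]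
    · have h1 : β k = ((‖b (α k)‖⁻¹ : ℝ) : ℂ) • b (α k) := congrArg Subtype.val (hB k hk)
      rw [h1, smul_smul, ← Complex.ofReal_mul, mul_inv_cancel₀ (norm_ne_zero_iff.2 hk),
        Complex.ofReal_one, one_smul]
  have hαβ : ∀ j k, ⟪α j, β k⟫_ℂ = if j = k then (Real.cos (θ k) : ℂ) else 0 := by
    intro j k
    have h1 : b (β k) = β k := apply_of_mem_range hb.1 (B k).2
    rw [← h1, ← inner_apply_comm hb.1.isSelfAdjoint, hbβ, inner_smul_left, Complex.conj_ofReal,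
      orthonormal_iff_ite.1 hβ]
    split_ifs with hjk
    · rw [hjk, mul_one]
    · rw [mul_zero]
  have hβα : ∀ j k, ⟪β j, α k⟫_ℂ = if j = k then (Real.cos (θ k) : ℂ) else 0 := by
    intro j k
    rw [← inner_conj_symm, hαβ]
    by_cases hjk : j = k
    · rw [if_pos hjk.symm, if_pos hjk, Complex.conj_ofReal, hjk]
    · simp [hjk, Ne.symm hjk]
  -- the components of the `β k` orthogonal to the span of the `α k`
  set η : Fin r → H := fun k => β k - (Real.cos (θ k) : ℂ) • α k with hη
  have hαη : ∀ j k, ⟪α j, η k⟫_ℂ = 0 := by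
    intro j k
    rw [hη, inner_sub_right, inner_smul_right, hαβ, orthonormal_iff_ite.1 hα]
    split_ifs <;> simp
  have hηη : ∀ j k, ⟪η j, η k⟫_ℂ = if j = k then ((Real.sin (θ k) ^ 2 : ℝ) : ℂ) else 0 := by
    intro j k
    have h1 : ⟪η j, η k⟫_ℂ = ⟪β j, η k⟫_ℂ := by
      conv_lhs => rw [hη]
      rw [inner_sub_left, inner_smul_left, hαη, mul_zero, sub_zero]
    rw [h1, hη, inner_sub_right, inner_smul_right, hβα, orthonormal_iff_ite.1 hβ]
    split_ifs with hjk
    · rw [Real.sin_sq]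
      push_cast
      ring
    · simp
  have hnη : ∀ k, ‖η k‖ ^ 2 = Real.sin (θ k) ^ 2 := by
    intro k
    have h1 := hηη k k
    rw [if_pos rfl, inner_self_eq_ofReal] at h1
    exact Complex.ofReal_injective h1
  have hs0 : ∀ k, 0 ≤ Real.sin (θ k) := fun k =>
    Real.sin_nonneg_of_nonneg_of_le_pi (hθ k).1 (by linarith [(hθ k).2, Real.pi_pos])
  have hnη' : ∀ k, ‖η k‖ = Real.sin (θ k) := fun k =>
    (pow_left_inj₀ (norm_nonneg _) (hs0 k) two_ne_zero).1 (hnη k)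
  -- for `sin (θ k) = 0` also `η k = 0`, so the junk value of the inverse does no harm
  have hrot : rotate α (fun k => ((Real.sin (θ k))⁻¹ : ℂ) • η k) θ 1 = β := by
    ext k
    have h1 : (Real.sin (θ k) : ℂ) • (((Real.sin (θ k))⁻¹ : ℂ) • η k) = η k := by
      by_cases hk : Real.sin (θ k) = 0
      · have h2 : η k = 0 := norm_eq_zero.1 ((hnη' k).trans hk)
        simp [h2]
      · rw [smul_smul, mul_inv_cancel₀ (by exact_mod_cast hk), one_smul]
    rw [rotate, one_mul, h1]
    simp only [hη]
    abel
  refine ⟨fun k => ((Real.sin (θ k))⁻¹ : ℂ) • η k, ⟨hα, fun j k => ?_, fun j k hjk => ?_,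
    fun k => ?_⟩, hrot ▸ hβb⟩
  · rw [inner_smul_right, hαη, mul_zero]
  · show ⟪((Real.sin (θ j))⁻¹ : ℂ) • η j, ((Real.sin (θ k))⁻¹ : ℂ) • η k⟫_ℂ = 0
    rw [inner_smul_right, inner_smul_left, hηη, if_neg hjk, mul_zero, mul_zero]
  · by_cases hk : Real.sin (θ k) = 0
    · right
      refine ⟨by rw [hk]; simp, ?_⟩
      exact (Real.sin_eq_zero_iff_of_lt_of_lt (by linarith [(hθ k).1, Real.pi_pos])
        (by linarith [(hθ k).2, Real.pi_pos])).1 hk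
    · left
      rw [norm_smul, norm_inv, Complex.norm_real, Real.norm_eq_abs, abs_of_nonneg (hs0 k), hnη',
        inv_mul_cancel₀ hk]

theorem exists_isRotationData_of_mem {r : ℕ} {a b : H →L[ℂ] H} (ha : a ∈ Mr H r)
    (hb : b ∈ Mr H r) : ∃ (α ξ : Fin r → H) (θ : Fin r → ℝ), IsRotationData α ξ θ ∧
      sumProj α = a ∧ sumProj (rotate α ξ θ 1) = b ∧ ∀ k, θ k ∈ Set.Icc 0 (Real.pi / 2) := by
  obtain ⟨α, hα, hαa, hd⟩ := exists_orthonormal_diagonal ha hb.1.isSelfAdjoint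
  have hle : ∀ k, ‖b (α k)‖ ≤ 1 := fun k =>
    (b.le_opNorm_of_le (hα.1 k).le).trans (by rw [mul_one]; exact hb.1.norm_le)
  have hθ : ∀ k, Real.arccos ‖b (α k)‖ ∈ Set.Icc 0 (Real.pi / 2) := fun k =>
    ⟨Real.arccos_nonneg _, Real.arccos_le_pi_div_two.2 (norm_nonneg _)⟩
  obtain ⟨ξ, h1, h2⟩ := exists_isRotationData hb hα hd hθ fun k =>
    (Real.cos_arccos (by linarith [norm_nonneg (b (α k))]) (hle k)).symm
  exact ⟨α, ξ, _, h1, hαa, h2, hθ⟩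

/-! ### Spectral data -/

omit [CompleteSpace H] in
theorem mul_rankOne_eq (T : H →L[ℂ] H) (x y : H) :
    T * InnerProductSpace.rankOne ℂ x y = InnerProductSpace.rankOne ℂ (T x) y :=
  InnerProductSpace.comp_rankOne _ _ _

theorem rankOne_mul_eq {T : H →L[ℂ] H} (hT : IsSelfAdjoint T) (x y : H) :
    InnerProductSpace.rankOne ℂ x y * T = InnerProductSpace.rankOne ℂ x (T y) := by
  ext z
  simp [inner_apply_comm hT]

theorem rankOne_add_rankOne_mem_halfSpace {p : H →L[ℂ] H} (hp : IsStarProjection p) {x y : H}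
    (hx : p x = x) (hy : p y = 0) :
    InnerProductSpace.rankOne ℂ x y + InnerProductSpace.rankOne ℂ y x ∈ halfSpace p := by
  rw [mem_halfSpace_iff hp]
  simp only [mul_add, add_mul, mul_rankOne_eq, rankOne_mul_eq hp.isSelfAdjoint, hx, hy, map_zero,
    zero_apply, add_zero, zero_add]

theorem IsRotationData.isSpectralData {r : ℕ} {α ξ : Fin r → H} {θ : Fin r → ℝ}
    (h : IsRotationData α ξ θ) (hθ : ∀ k, θ k ∈ Set.Icc 0 (Real.pi / 2)) :
    IsSpectralData (sumProj α) (sumProj (rotate α ξ θ 1))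
      (fun k => InnerProductSpace.rankOne ℂ (α k) (α k))
      (fun k => InnerProductSpace.rankOne ℂ (α k) (ξ k) + InnerProductSpace.rankOne ℂ (ξ k) (α k))
      (fun k => 1 / 2 * Real.sin (2 * θ k)) θ := by
  have hα := h.orthonormal
  have hp := isStarProjection_sumProj hα
  have hξ : ∀ k, sumProj α (ξ k) = 0 := fun k => by simp [sumProj_apply, h.inner_eq_zero]
  have hsa : ∀ k, IsSelfAdjoint (InnerProductSpace.rankOne ℂ (α k) (ξ k) +
      InnerProductSpace.rankOne ℂ (ξ k) (α k)) := fun k => by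
    rw [IsSelfAdjoint, star_add, star_rankOne, star_rankOne, add_comm]
  have hrot : ∀ k, sumProj α (rotate α ξ θ 1 k) = (Real.cos (θ k) : ℂ) • α k := fun k => by
    rw [rotate, map_add, map_smul, map_smul, hξ, smul_zero, add_zero, one_mul,
      sumProj_apply_self hα]
  refine ⟨isFrame_rankOne hα, fun k => ⟨rankOne_add_rankOne_mem_halfSpace hp
    (sumProj_apply_self hα k) (hξ k), hsa k⟩, fun k => ?_, fun k => ?_, fun k hk h0 => ?_,
    fun j k hjk z => ?_, fun k => ?_, ?_, ?_, hθ⟩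
  · exact rankOne_add_rankOne_mem_halfSpace (isStarProjection_rankOne (hα.1 k))
      (by simp [hα.1 k]) (by simp [h.inner_eq_zero])
  · show quad _ _ = _
    rw [quad_eq, (hsa k).star_eq]
    ext x
    rcases h.norm_eq k with h1 | h1
    · simp [inner_add_right, inner_smul_right, h.inner_eq_zero, h.inner_eq_zero', h1, hα.1 k,
        add_comm]
    · simp [h1]
  · rcases h.norm_eq k with h1 | h1
    · have h2 := congrArg (fun z : H →L[ℂ] H => z (α k)) h0
      have h3 : ξ k = 0 := by simpa [h.inner_eq_zero', hα.1 k] using h2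
      rw [h3, norm_zero] at h1
      exact zero_ne_one h1
    · exact hk (by simp [h1.2])
  · have h1 : ∀ j k, j ≠ k →
        (InnerProductSpace.rankOne ℂ (α j) (ξ j) + InnerProductSpace.rankOne ℂ (ξ j) (α j)) *
        (InnerProductSpace.rankOne ℂ (α k) (ξ k) + InnerProductSpace.rankOne ℂ (ξ k) (α k)) =
          0 := by
      intro j k hjk
      have h2 : ⟪α j, α k⟫_ℂ = 0 := hα.2 hjk
      have h3 : ⟪ξ j, ξ k⟫_ℂ = 0 := h.orthogonal hjk
      ext x
      simp [inner_add_right, inner_smul_right, h.inner_eq_zero, h.inner_eq_zero', h2, h3]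
    rw [triple, (hsa k).star_eq, h1 j k hjk, mul_assoc z, h1 k j hjk.symm]
    simp
  · exact mul_nonneg (by norm_num) (Real.sin_nonneg_of_nonneg_of_le_pi
      (by linarith [(hθ k).1]) (by linarith [(hθ k).2]))
  · rw [peirceHalf_eq hp, sumProj.eq_1 (rotate α ξ θ 1)]
    simp only [Finset.mul_sum, Finset.sum_mul, Finset.smul_sum, ← Finset.sum_add_distrib,
      ← Finset.sum_sub_distrib]
    refine Finset.sum_congr rfl fun k _ => ?_
    simp only [mul_rankOne_eq, rankOne_mul_eq hp.isSelfAdjoint, hrot]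
    rw [rotate, one_mul, Real.sin_two_mul]
    simp only [map_add, map_smul, map_smulₛₗ, add_apply, smul_apply, Complex.conj_ofReal]
    push_cast
    module
  · rw [peirceOne_eq hp, sumProj.eq_1 (rotate α ξ θ 1)]
    simp only [Finset.mul_sum, Finset.sum_mul]
    refine Finset.sum_congr rfl fun k _ => ?_
    simp only [mul_rankOne_eq, rankOne_mul_eq hp.isSelfAdjoint, hrot]
    simp only [map_smul, map_smulₛₗ, smul_apply, Complex.conj_ofReal]
    push_cast
    module

namespace IsSpectralData

variable {r : ℕ} {a b : H →L[ℂ] H} {e w : Fin r → H →L[ℂ] H} {ρ θ : Fin r → ℝ}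

theorem inner_apply {α : Fin r → H} (h : IsSpectralData a b e w ρ θ) (hα : Orthonormal ℂ α)
    (ha : sumProj α = a) (he : ∀ k, e k = InnerProductSpace.rankOne ℂ (α k) (α k))
    (j k : Fin r) : ⟪α j, b (α k)⟫_ℂ = if j = k then ((Real.cos (θ k) ^ 2 : ℝ) : ℂ) else 0 := by
  have hp : IsStarProjection a := ha ▸ isStarProjection_sumProj hα
  have haα : ∀ k, a (α k) = α k := fun k => by rw [← ha, sumProj_apply_self hα]
  have h1 := congrArg (fun z : H →L[ℂ] H => ⟪α j, z (α k)⟫_ℂ) h.one_eq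
  simp only [peirceOne_eq hp, mul_apply_eq_comp, haα, ← inner_apply_comm hp.isSelfAdjoint, he,
    sum_apply, smul_apply, InnerProductSpace.rankOne_apply, orthonormal_iff_ite.1 hα] at h1
  rw [h1]
  simp [orthonormal_iff_ite.1 hα]

theorem norm_apply {α : Fin r → H} (h : IsSpectralData a b e w ρ θ) (hα : Orthonormal ℂ α)
    (ha : sumProj α = a) (he : ∀ k, e k = InnerProductSpace.rankOne ℂ (α k) (α k))
    (hb : IsStarProjection b) (k : Fin r) : ‖b (α k)‖ = Real.cos (θ k) := by
  have h1 := h.inner_apply hα ha he k k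
  rw [if_pos rfl, inner_apply_eq_norm_sq hb] at h1
  have h3 : ‖b (α k)‖ ^ 2 = Real.cos (θ k) ^ 2 := Complex.ofReal_injective h1
  exact (pow_left_inj₀ (norm_nonneg _) (Real.cos_nonneg_of_mem_Icc
    ⟨by linarith [(h.angle k).1, Real.pi_pos], (h.angle k).2⟩) two_ne_zero).1 h3

theorem riemannDist_eq (h : IsSpectralData a b e w ρ θ) (hb : b ∈ Mr H r) :
    riemannDist r a b = ENNReal.ofReal (1 / √(r : ℝ) * √(∑ k, θ k ^ 2)) := by
  obtain ⟨α, hα, ha, he⟩ := h.frame.exists_orthonormal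
  obtain ⟨ξ, h1, h2⟩ := exists_isRotationData hb hα
    (fun j k hjk => (h.inner_apply hα ha he j k).trans (if_neg hjk)) h.angle
    (h.norm_apply hα ha he hb.1)
  have h3 := h1.riemannDist_eq h.angle
  rwa [ha, h2] at h3

/-- Both sides are the norm of `P_{1/2}(a) b` at a unit vector in the range of `e k`. -/
theorem rho_eq (h : IsSpectralData a b e w ρ θ) (hb : IsStarProjection b) (k : Fin r) :
    ρ k = 1 / 2 * Real.sin (2 * θ k) := by
  obtain ⟨α, hα, ha, he⟩ := h.frame.exists_orthonormal
  have hp : IsStarProjection a := ha ▸ isStarProjection_sumProj hα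
  have haα : ∀ k, a (α k) = α k := fun k => by rw [← ha, sumProj_apply_self hα]
  have hpe : ∀ k, IsStarProjection (e k) := fun k => he k ▸ isStarProjection_rankOne (hα.1 k)
  have hin : ∀ i j k, ⟪α i, w j (α k)⟫_ℂ = 0 := by
    intro i j k
    have h1 := congrArg (fun z : H →L[ℂ] H => ⟪α i, z (α k)⟫_ℂ)
      (corner_eq_zero hp (h.tangent j).1)
    simpa [haα, ← inner_apply_comm hp.isSelfAdjoint] using h1
  have hw0 : ∀ j, j ≠ k → w j (α k) = 0 := by
    intro j hjk
    have h1 := congrArg (fun z : H →L[ℂ] H => z (α k)) ((mem_halfSpace_iff (hpe j)).1 (h.assoc j))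
    have h2 : ⟪α j, α k⟫_ℂ = 0 := hα.2 hjk
    simpa [he, hin, h2] using h1.symm
  have hL : ‖peirceHalf a b (α k)‖ = Real.cos (θ k) * Real.sin (θ k) := by
    have hs : 0 ≤ Real.sin (θ k) := Real.sin_nonneg_of_nonneg_of_le_pi (h.angle k).1
      (by linarith [(h.angle k).2, Real.pi_pos])
    have hc : 0 ≤ Real.cos (θ k) := Real.cos_nonneg_of_mem_Icc
      ⟨by linarith [(h.angle k).1, Real.pi_pos], (h.angle k).2⟩
    have h1 : peirceHalf a b (α k) = b (α k) - ((Real.cos (θ k) ^ 2 : ℝ) : ℂ) • α k := by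
      have h2 : a (b (α k)) = ((Real.cos (θ k) ^ 2 : ℝ) : ℂ) • α k := by
        rw [← ha, sumProj_apply]
        simp only [h.inner_apply hα ha he, ite_smul, zero_smul, Finset.sum_ite_eq',
          Finset.mem_univ, if_true]
      simp only [peirceHalf_eq hp, sub_apply, add_apply, smul_apply, mul_apply_eq_comp, haα, h2]
      module
    refine (pow_left_inj₀ (norm_nonneg _) (mul_nonneg hc hs) two_ne_zero).1 ?_
    rw [h1, norm_sub_sq (𝕜 := ℂ), inner_smul_right, ← inner_conj_symm,
      h.inner_apply hα ha he k k, if_pos rfl, norm_smul, hα.1 k, h.norm_apply hα ha he hb,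
      Complex.conj_ofReal, ← Complex.ofReal_mul, RCLike.re_eq_complex_re, Complex.ofReal_re,
      Complex.norm_real, Real.norm_eq_abs, mul_one, sq_abs, mul_pow, Real.sin_sq]
    ring
  have hR : ‖peirceHalf a b (α k)‖ = ρ k * ‖w k (α k)‖ := by
    rw [h.half_eq, sum_apply, Finset.sum_eq_single_of_mem k (Finset.mem_univ k), smul_apply,
      norm_smul, Complex.norm_real, Real.norm_eq_abs, abs_of_nonneg (h.nonneg k)]
    intro j _ hjk
    rw [smul_apply, hw0 j hjk, smul_zero]
  -- a nonzero `w k` is a tripotent of the form `(·, α k) ξ + (·, ξ) α k`, which forces `‖ξ‖ = 1`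
  have hkey : ρ k * ‖w k (α k)‖ = ρ k := by
    by_cases hρ : ρ k = 0
    · rw [hρ, zero_mul]
    have hw := h.ne_zero k hρ
    have hsa : IsSelfAdjoint (w k) := (h.tangent k).2
    have hwk := (mem_halfSpace_iff (hpe k)).1 (h.assoc k)
    have hwα : ∀ x, w k x = ⟪w k (α k), x⟫_ℂ • α k + ⟪α k, x⟫_ℂ • w k (α k) := by
      intro x
      have h1 := congrArg (fun z : H →L[ℂ] H => z x) hwk
      simpa [he, inner_apply_comm hsa] using h1.symm
    have h0 : w k (α k) ≠ 0 := by
      intro h1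
      refine hw (ContinuousLinearMap.ext fun x => ?_)
      rw [hwα x, h1]
      simp
    have htri : w k (w k (w k (α k))) = w k (α k) := by
      have h1 : quad (w k) (w k) = w k := h.tripotent k
      rw [quad_eq, hsa.star_eq] at h1
      exact congrArg (fun z : H →L[ℂ] H => z (α k)) h1
    have h2 : w k (w k (α k)) = ((‖w k (α k)‖ ^ 2 : ℝ) : ℂ) • α k := by
      rw [hwα (w k (α k)), hin, zero_smul, add_zero, inner_self_eq_ofReal]
    rw [h2, map_smul] at htri
    have h3 : ((‖w k (α k)‖ ^ 2 : ℝ) : ℂ) = 1 := by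
      refine smul_left_injective ℂ h0 ?_
      simpa using htri
    have h4 : ‖w k (α k)‖ ^ 2 = 1 ^ 2 := by rw [one_pow]; exact_mod_cast h3
    rw [(pow_left_inj₀ (norm_nonneg _) zero_le_one two_ne_zero).1 h4, mul_one]
  rw [← hkey, ← hR, hL, Real.sin_two_mul]
  ring

end IsSpectralData

/-! ### Rank one -/

theorem riemannDist_rankOne {α β : H} (hα : ‖α‖ = 1) (hβ : ‖β‖ = 1) :
    riemannDist 1 (InnerProductSpace.rankOne ℂ α α) (InnerProductSpace.rankOne ℂ β β) =
      ENNReal.ofReal (Real.arccos ‖⟪α, β⟫_ℂ‖) := by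
  have ho : ∀ {x : H}, ‖x‖ = 1 → Orthonormal ℂ (fun _ : Fin 1 => x) := fun hx =>
    ⟨fun _ => hx, fun j k hjk => absurd (Subsingleton.elim j k) hjk⟩
  have hs : ∀ x : H, sumProj (fun _ : Fin 1 => x) = InnerProductSpace.rankOne ℂ x x := fun x => by
    simp [sumProj]
  have hle : ‖⟪α, β⟫_ℂ‖ ≤ 1 := by
    simpa [hα, hβ] using norm_inner_le_norm (𝕜 := ℂ) α β
  have hθ : Real.arccos ‖⟪α, β⟫_ℂ‖ ∈ Set.Icc 0 (Real.pi / 2) :=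
    ⟨Real.arccos_nonneg _, Real.arccos_le_pi_div_two.2 (norm_nonneg _)⟩
  obtain ⟨ξ, h1, h2⟩ := exists_isRotationData (hs β ▸ sumProj_mem_Mr (ho hβ)) (ho hα)
    (fun j k hjk => absurd (Subsingleton.elim j k) hjk) (fun _ => hθ) fun _ => by
      rw [InnerProductSpace.rankOne_apply, norm_smul, hβ, mul_one, norm_inner_symm,
        Real.cos_arccos (by linarith [norm_nonneg ⟪α, β⟫_ℂ]) hle]
  have h3 := h1.riemannDist_eq fun _ => hθ
  rw [h2, hs] at h3
  rw [h3]
  simp [Real.sqrt_sq hθ.1]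

end FiniteRankProj

end

theorem mainTheorem3 {H : Type*} [NormedAddCommGroup H] [InnerProductSpace ℂ H] [CompleteSpace H]
    (r : ℕ) (hr : 1 ≤ r) :
    -- the metric does not depend on the frame, and is invariant
    (∀ a ∈ FiniteRankProj.Mr H r, ∀ u ∈ FiniteRankProj.halfSpace a,
      ∀ v ∈ FiniteRankProj.halfSpace a,
        (∀ e : Fin r → H →L[ℂ] H, FiniteRankProj.IsFrame a e →
          FiniteRankProj.metric r a u v = FiniteRankProj.frameForm e u v) ∧
        (∀ φ : (H →L[ℂ] H) ≃L[ℂ] (H →L[ℂ] H), FiniteRankProj.IsTripleAut φ →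
          φ a ∈ FiniteRankProj.Mr H r →
          FiniteRankProj.metric r (φ a) (φ u) (φ v) = FiniteRankProj.metric r a u v)) ∧
    -- geodesics minimize up to the angle `π / 2`
    (∀ (J : Set ℝ) (γ : ℝ → H →L[ℂ] H), J.OrdConnected → FiniteRankProj.IsGeodesicOn r J γ →
      ∀ s ∈ J, ∀ t ∈ J, s ≤ t → (t - s) * ‖derivWithin γ J s‖ ≤ Real.pi / 2 →
        FiniteRankProj.curveLength r γ s t = FiniteRankProj.riemannDist r (γ s) (γ t)) ∧
    -- any two points are joined by a minimizing geodesic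
    (∀ a ∈ FiniteRankProj.Mr H r, ∀ b ∈ FiniteRankProj.Mr H r,
      ∃ γ : ℝ → H →L[ℂ] H, FiniteRankProj.IsGeodesicOn r Set.univ γ ∧ γ 0 = a ∧ γ 1 = b ∧
        FiniteRankProj.curveLength r γ 0 1 = FiniteRankProj.riemannDist r a b) ∧
    -- the distance formula
    (∀ a ∈ FiniteRankProj.Mr H r, ∀ b ∈ FiniteRankProj.Mr H r,
      (∃ (e w : Fin r → H →L[ℂ] H) (ρ θ : Fin r → ℝ),
        FiniteRankProj.IsSpectralData a b e w ρ θ) ∧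
      ∀ (e w : Fin r → H →L[ℂ] H) (ρ θ : Fin r → ℝ),
        FiniteRankProj.IsSpectralData a b e w ρ θ →
          (∀ k, ρ k = 1 / 2 * Real.sin (2 * θ k)) ∧
          FiniteRankProj.riemannDist r a b =
            ENNReal.ofReal (1 / √(r : ℝ) * √(∑ k, θ k ^ 2))) ∧
    -- for rank one it is the Fubini-Study distance
    (∀ α β : H, ‖α‖ = 1 → ‖β‖ = 1 →
      FiniteRankProj.riemannDist 1 (InnerProductSpace.rankOne ℂ α α)
        (InnerProductSpace.rankOne ℂ β β) = ENNReal.ofReal (Real.arccos ‖⟪α, β⟫_ℂ‖)) := by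
  refine ⟨fun a ha u hu v hv => ⟨fun e he => FiniteRankProj.metric_eq_frameForm he hu hv,
    fun φ hφ ha' => hφ.metric_map ha ha' hu hv⟩,
    fun J γ hJ h s hs t ht hst hle => h.curveLength_eq_riemannDist hJ hs ht hst hle,
    fun a ha b hb => ?_, fun a ha b hb => ⟨?_, fun e w ρ θ h =>
      ⟨h.rho_eq hb.1, h.riemannDist_eq hb⟩⟩,
    fun α β hα hβ => FiniteRankProj.riemannDist_rankOne hα hβ⟩
  · obtain ⟨α, ξ, θ, h, rfl, rfl, hθ⟩ := FiniteRankProj.exists_isRotationData_of_mem ha hb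
    refine ⟨_, h.isGeodesicOn, ?_, rfl, h.curveLength_eq.trans (h.riemannDist_eq hθ).symm⟩
    simp only [FiniteRankProj.IsRotationData.rotate_zero]
  · obtain ⟨α, ξ, θ, h, rfl, rfl, hθ⟩ := FiniteRankProj.exists_isRotationData_of_mem ha hb
    exact ⟨_, _, _, _, h.isSpectralData hθ⟩
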